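/- Conventions. For $0\le k\le n+2$ let $\mathbf R_k^{n+2}$ be $\mathbf R^{n+2}$ with the metric $\langle v,w\rangle=-v_1w_1-\dots-v_kw_k+v_{k+1}w_{k+1}+\dots+v_{n+2}w_{n+2}$, and let $\mathbf S_k^{n+1}=\{x\in\mathbf R_k^{n+2}:\langle x,x\rangle=1\}$, so that $\mathbf S_1^{n+1}$ is de Sitter space. For $1\le k\le n$ let $\mathbf S_{k-1}^{n-1}=\{y\in\mathbf S_k^{n+1}: y_k=y_{k+1}=0\}$; for $k=1$ this is the round unit sphere $S^{n-1}$. A semi-Riemannian hypersurface immersion into $\mathbf S_k^{n+1}$ has constant mean curvature $h$ if, for some smooth unit normal field $\nu$ (with $\langle\nu,\nu\rangle$ constantly $1$ or constantly $-1$), the shape operator $A=-d\nu$ satisfies $\frac1n\operatorname{tr}A=h$ everywhere. An immersion is called closed if it is a proper map (in particular it is then a closed map with closed image). Theorem. Let $n\ge 3$ be an integer and let $h\in\left[-1,-\frac{2\sqrt{n-1}}{n}\right)$. Then there exist a constant $c>0$ and a non-constant smooth function $g:\mathbf R\to\mathbf R$ with $g(t)>\sqrt c$ and $$(g'(t))^2=c-g(t)^2+g(t)^2\left(h+g(t)^{-n}\right)^2\qquad\text{for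 all }t\in\mathbf R,$$ such that, with $$r=\frac{g}{\sqrt c},\qquad \lambda=h+g^{-n},\qquad \theta(u)=\int_0^u\frac{r(\tau)\lambda(\tau)}{r(\tau)^2-1}\,d\tau,\qquad B_2(t)=(0,\dots,0,\cosh t,\sinh t,0,\dots,0)$$ (the nonzero entries of $B_2$ being those with indices $k$ and $k+1$), the following hold. (1) For every integer $k$ with $1\le k\le n$, the map $\phi:\mathbf S_{k-1}^{n-1}\times\mathbf R\to\mathbf S_k^{n+1}$, $$\phi(y,u)=r(u)\,y+\sqrt{r(u)^2-1}\;B_2(\theta(u)),$$ is a closed smooth immersion with nondegenerate induced metric, and it has constant mean curvature $h$. (2) For $k=1$ the immersion $\phi:S^{n-1}\times\mathbf R\to\mathbf S_1^{n+1}$ into de Sitter space is spacelike (its induced metric is positive definite), and the induced Riemannian metric on $S^{n-1}\times\mathbf R$ is complete. -/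

import Mathlib

open scoped ContDiff

noncomputable section

namespace CMC

/-- The vector space underlying the semi-Euclidean space `R_k^{n+2}`. The norm that this type
carries is used only for its topology and its notion of smoothness. -/
abbrev V (n : ℕ) : Type := Fin (n + 2) → ℝ

/-- The metric of `R_k^{n+2}`: the first `k` coordinates carry a minus sign. -/
def form (n k : ℕ) (v w : V n) : ℝ :=
  ∑ i : Fin (n + 2), (if (i : ℕ) < k then -(v i * w i) else v i * w i)

/-- `S_k^{n+1} = {x ∈ R_k^{n+2} : ⟨x, x⟩ = 1}`; for `k = 1` this is de Sitter space. -/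
def pseudoSphere (n k : ℕ) : Set (V n) := {x | form n k x x = 1}

/-- The copy of `R_{k-1}^n` inside `R_k^{n+2}` on which the `k`-th and the `(k+1)`-st coordinates
(counted from one) vanish. -/
def subspace (n k : ℕ) : Submodule ℝ (V n) where
  carrier := {x | ∀ i : Fin (n + 2), ((i : ℕ) + 1 = k ∨ (i : ℕ) = k) → x i = 0}
  add_mem' := by
    intro a b ha hb i hi
    simp [ha i hi, hb i hi]
  zero_mem' := by
    intro i _
    rfl
  smul_mem' := by
    intro c x hx i hi
    simp [hx i hi]

/-- The pseudo-sphere `S_{k-1}^{n-1}`, sitting in the above copy of `R_{k-1}^n`. For `k = 1` it is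
the round unit sphere of dimension `n - 1`. -/
def innerSphere (n k : ℕ) : Set (V n) := {y | y ∈ subspace n k ∧ form n k y y = 1}

/-- The manifold `S_{k-1}^{n-1} × R`, a closed submanifold of `R^{n+2} × R`. -/
def cylinder (n k : ℕ) : Set (V n × ℝ) := {p | p.1 ∈ innerSphere n k}

/-- The tangent space of `S_{k-1}^{n-1} × R` at `p = (y, u)`: the vectors `(v, s)` with `v` in
`R_{k-1}^n` and `⟨y, v⟩ = 0`. -/
def tangent (n k : ℕ) (p : V n × ℝ) : Submodule ℝ (V n × ℝ) where
  carrier := {w | w.1 ∈ subspace n k ∧ form n k p.1 w.1 = 0}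
  add_mem' := by
    rintro a b ⟨ha, ha'⟩ ⟨hb, hb'⟩
    refine ⟨(subspace n k).add_mem ha hb, ?_⟩
    have : form n k p.1 (a + b).1 = form n k p.1 a.1 + form n k p.1 b.1 := by
      simp only [form, ← Finset.sum_add_distrib, Prod.fst_add, Pi.add_apply]
      refine Finset.sum_congr rfl fun i _ => ?_
      split_ifs <;> ring
    rw [this, ha', hb', add_zero]
  zero_mem' := by
    refine ⟨(subspace n k).zero_mem, ?_⟩
    simp [form]
  smul_mem' := by
    rintro c x ⟨hx, hx'⟩
    refine ⟨(subspace n k).smul_mem c hx, ?_⟩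
    have : form n k p.1 (c • x).1 = c * form n k p.1 x.1 := by
      simp only [form, Finset.mul_sum, Prod.smul_fst, Pi.smul_apply, smul_eq_mul]
      refine Finset.sum_congr rfl fun i _ => ?_
      split_ifs <;> ring
    rw [this, hx', mul_zero]

/-! Smooth maps on the closed submanifold `S_{k-1}^{n-1} × R` are given as (restrictions of) smooth
maps `f` on the surrounding space; the differential of the restriction at `p` is
`fderiv ℝ f p` on `tangent n k p`. -/

/-- The semi-Riemannian metric that `f` induces from `R_k^{n+2}`, at the point `p`. -/
def induced (n k : ℕ) (f : V n × ℝ → V n) (p w w' : V n × ℝ) : ℝ :=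
  form n k (fderiv ℝ f p w) (fderiv ℝ f p w')

/-- `f` restricts to a closed immersion of the whole of `S_{k-1}^{n-1} × R` into `S_k^{n+1}`
as a semi-Riemannian hypersurface: it is a smooth immersion with nondegenerate induced metric,
and it is proper as a map `S_{k-1}^{n-1} × R → S_k^{n+1}` (hence a closed map, with
closed image). -/
structure IsClosedImm (n k : ℕ) (f : V n × ℝ → V n) : Prop where
  smooth : ContDiff ℝ ∞ f
  mapsTo : Set.MapsTo f (cylinder n k) (pseudoSphere n k)
  injective : ∀ p ∈ cylinder n k, ∀ w ∈ tangent n k p, fderiv ℝ f p w = 0 → w = 0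
  nondegenerate : ∀ p ∈ cylinder n k, ∀ w ∈ tangent n k p,
    (∀ w' ∈ tangent n k p, induced n k f p w w' = 0) → w = 0
  proper : IsProperMap (Set.MapsTo.restrict f (cylinder n k) (pseudoSphere n k) mapsTo)

/-- `ν` is a Gauss map of the hypersurface `f` in `S_k^{n+1}`: a smooth field along `f` which is
tangent to `S_k^{n+1}`, normal to the hypersurface, and of constant square length `1` or `-1`. -/
structure IsGaussMap (n k : ℕ) (f ν : V n × ℝ → V n) : Prop where
  smooth : ContDiff ℝ ∞ ν
  tangent_ambient : ∀ p ∈ cylinder n k, form n k (ν p) (f p) = 0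
  normal : ∀ p ∈ cylinder n k, ∀ w ∈ tangent n k p, form n k (ν p) (fderiv ℝ f p w) = 0
  unit : ∃ ε : ℝ, (ε = 1 ∨ ε = -1) ∧ ∀ p ∈ cylinder n k, form n k (ν p) (ν p) = ε

/-- The hypersurface `f` has constant mean curvature `h`: for some Gauss map `ν`, at every point
the shape operator `A`, given by `dν = -df ∘ A`, has `(1 / n) * trace A = h` (the average of
the principal curvatures). -/
def HasCMC (n k : ℕ) (f : V n × ℝ → V n) (h : ℝ) : Prop :=
  ∃ ν : V n × ℝ → V n, IsGaussMap n k f ν ∧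
    ∀ p ∈ cylinder n k, ∃ A : tangent n k p →ₗ[ℝ] tangent n k p,
      (∀ w : tangent n k p,
        fderiv ℝ ν p (w : V n × ℝ) = -(fderiv ℝ f p (A w : V n × ℝ))) ∧
      (1 / (n : ℝ)) * LinearMap.trace ℝ (tangent n k p) A = h

/-- The induced metric is positive definite. -/
def IsSpacelike (n k : ℕ) (f : V n × ℝ → V n) : Prop :=
  ∀ p ∈ cylinder n k, ∀ w ∈ tangent n k p, w ≠ 0 → 0 < induced n k f p w w

/-- Length, in the induced metric, of a curve parametrised by `[0, 1]`. -/
def length (n k : ℕ) (f : V n × ℝ → V n) (γ : ℝ → V n × ℝ) : ENNReal :=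
  ∫⁻ t in Set.Icc (0 : ℝ) 1, ENNReal.ofReal (Real.sqrt
    (induced n k f (γ t) (derivWithin γ (Set.Icc 0 1) t) (derivWithin γ (Set.Icc 0 1) t)))

/-- The distance of the induced metric (when it is Riemannian): the infimum of the lengths of the
`C^1` curves in `S_{k-1}^{n-1} × R` from `p` to `q`. -/
def dist (n k : ℕ) (f : V n × ℝ → V n) (p q : V n × ℝ) : ENNReal :=
  ⨅ (γ : ℝ → V n × ℝ) (_ : ContDiffOn ℝ 1 γ (Set.Icc 0 1))
    (_ : ∀ t ∈ Set.Icc (0 : ℝ) 1, γ t ∈ cylinder n k) (_ : γ 0 = p) (_ : γ 1 = q),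
    length n k f γ

/-- `S_{k-1}^{n-1} × R` with the metric induced by `f` is complete: every Cauchy sequence for the
induced distance converges. -/
def IsCompleteMetric (n k : ℕ) (f : V n × ℝ → V n) : Prop :=
  ∀ x : ℕ → V n × ℝ, (∀ i, x i ∈ cylinder n k) →
    (∀ ε : ENNReal, 0 < ε → ∃ N, ∀ i ≥ N, ∀ j ≥ N, dist n k f (x i) (x j) < ε) →
    ∃ p ∈ cylinder n k, Filter.Tendsto (fun i => dist n k f (x i) p) Filter.atTop (nhds 0)

/-- The function `q_1(t) = c - t² + t² (h + t^{-n})²`. -/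
def q₁ (n : ℕ) (h c t : ℝ) : ℝ := c - t ^ 2 + t ^ 2 * (h + t ^ (-(n : ℤ))) ^ 2

/-- `λ = h + g^{-n}`. -/
def lam (n : ℕ) (h : ℝ) (g : ℝ → ℝ) (u : ℝ) : ℝ := h + (g u) ^ (-(n : ℤ))

/-- `r = g / √c`. -/
def rad (c : ℝ) (g : ℝ → ℝ) (u : ℝ) : ℝ := g u / Real.sqrt c

/-- `θ(u) = ∫_0^u r λ / (r² - 1)`. -/
def theta (n : ℕ) (h c : ℝ) (g : ℝ → ℝ) (u : ℝ) : ℝ :=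
  ∫ τ in (0 : ℝ)..u, rad c g τ * lam n h g τ / (rad c g τ ^ 2 - 1)

/-- `B_2(t) = (0, …, 0, cosh t, sinh t, 0, …, 0)`, the nonzero entries standing at the places
`k` and `k + 1` (counted from one). -/
def B₂ (n k : ℕ) (t : ℝ) : V n := fun i =>
  if (i : ℕ) + 1 = k then Real.cosh t else if (i : ℕ) = k then Real.sinh t else 0

/-- `φ(y, u) = r(u) y + √(r(u)² - 1) B_2(θ(u))`. -/
def phi (n k : ℕ) (h c : ℝ) (g : ℝ → ℝ) (p : V n × ℝ) : V n :=
  rad c g p.2 • p.1 + Real.sqrt (rad c g p.2 ^ 2 - 1) • B₂ n k (theta n h c g p.2)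

end CMC

end

/-! Differentiating the equation for `g` gives `g'' = force(g)` with `force = q₁'/2`, the motion of
a particle of zero energy in the potential `-q₁`. The force is `-t` times the quadratic `1 + (n-1)λ²
- nhλ`, and the upper bound on `h` is exactly what makes this quadratic negative at its vertex. So
the force is positive at some `a` and at a nearby `b > a` (`exists_barrier`). Choosing `c` so that
`q₁` vanishes at `b`, the particle released at rest at `b` moves, and conservation of energy keeps
it to the right of `a > √c` for all time (`exists_solution_above`). The motion may be unbounded.

The hypersurface is rotational. In the frame `y`, `B₂`, `B₃ = B₂'` its induced metric is `r² ⟨dy,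
dy⟩ + du²` (`induced_eq`), and a timelike unit normal gives the principal curvatures `λ`
(multiplicity `n - 1`) and `μ = nh - (n-1)λ` (`fderiv_normalField`), whose mean is `h`.

Properness rests on `h ≥ -1`: it forces `λ² ≤ 1`, hence `|r'| ≤ 1` and linear growth of `r`. Since
`λ` is also bounded away from `0`, `|θ'|` is at least of order `1/|u|` and `θ` is unbounded in both
directions; a bounded image then bounds `u` and `y` (`exists_norm_le`). Completeness for `k = 1`
holds because `r > 1` makes the induced metric dominate the ambient norm on a closed subset
(`edist_le_dist`), while short explicit curves turn ambient convergence into convergence for the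
induced distance (`dist_le`). -/

open scoped ContDiff

/-! ### Global solutions of Lipschitz differential equations. -/

section GlobalFlow

variable {E : Type*} [NormedAddCommGroup E] [NormedSpace ℝ E]

/-- Integration reproduces the weight `cosh (L s)` and gains a factor `1 / L`; this makes the Picard
map contract in a weighted sup norm on the whole line. -/
theorem norm_integral_le_cosh {f : ℝ → E} {L C : ℝ} (hL : 0 < L)
    (hf : ∀ s, ‖f s‖ ≤ C * Real.cosh (L * s)) (t : ℝ) :
    ‖∫ s in (0 : ℝ)..t, f s‖ ≤ C / L * Real.cosh (L * t) := by
  have hC : 0 ≤ C := by simpa using (norm_nonneg _).trans (hf 0)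
  have hint : ∫ s in (0 : ℝ)..t, C * Real.cosh (L * s) = C / L * Real.sinh (L * t) := by
    have hd : ∀ s ∈ Set.uIcc 0 t,
        HasDerivAt (fun s => C / L * Real.sinh (L * s)) (C * Real.cosh (L * s)) s := by
      intro s _
      have h1 : HasDerivAt (fun s : ℝ => L * s) L s := by simpa using (hasDerivAt_id s).const_mul L
      exact (h1.sinh.const_mul (C / L)).congr_deriv (by field_simp)
    rw [intervalIntegral.integral_eq_sub_of_hasDerivAt hd
      (Continuous.intervalIntegrable (by fun_prop) _ _)]
    simp
  have h := intervalIntegral.norm_integral_le_abs_of_norm_le (μ := MeasureTheory.volume)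
    (a := 0) (b := t) (f := f) (g := fun s => C * Real.cosh (L * s))
    (Filter.Eventually.of_forall hf) (Continuous.intervalIntegrable (by fun_prop) _ _)
  rw [hint, abs_mul, abs_of_nonneg (by positivity), Real.abs_sinh] at h
  refine h.trans (mul_le_mul_of_nonneg_left ?_ (by positivity))
  rw [← Real.cosh_abs (L * t)]
  exact (Real.sinh_lt_cosh _).le

open BoundedContinuousFunction in
/-- A globally Lipschitz vector field on a Banach space has a complete flow. -/
theorem LipschitzWith.exists_forall_hasDerivAt [CompleteSpace E] {v : E → E} {K : NNReal}
    (hv : LipschitzWith K v) (x₀ : E) :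
    ∃ γ : ℝ → E, γ 0 = x₀ ∧ ∀ t, HasDerivAt γ (v (γ t)) t := by
  -- The unknown is the bounded function `x = γ / cosh (L t)`. In it the Picard map has Lipschitz
  -- constant `K / L ≤ 1/2`; the `+ 1` keeps `L` positive when `K = 0`.
  set L : ℝ := 2 * K + 1 with hLdef
  have hL : 0 < L := by positivity
  have hvc : Continuous v := hv.continuous
  have hcosh : ∀ s, 0 < Real.cosh (L * s) := fun s => Real.cosh_pos _
  have hgrow : ∀ y, ‖v y‖ ≤ ‖v 0‖ + K * ‖y‖ := by
    intro y
    have h1 := hv.norm_sub_le y 0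
    rw [sub_zero] at h1
    linarith [norm_sub_norm_le (v y) (v 0)]
  have hcont : ∀ x : ℝ →ᵇ E, Continuous fun s => v (Real.cosh (L * s) • x s) := fun x =>
    hvc.comp ((by fun_prop : Continuous fun s => Real.cosh (L * s)).smul x.continuous)
  have hprim : ∀ x : ℝ →ᵇ E, ∀ t, HasDerivAt
      (fun t => x₀ + ∫ s in (0 : ℝ)..t, v (Real.cosh (L * s) • x s))
      (v (Real.cosh (L * t) • x t)) t := fun x t =>
    ((hcont x).integral_hasStrictDerivAt 0 t).hasDerivAt.const_add _
  have hΨc : ∀ x : ℝ →ᵇ E, Continuous fun t =>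
      (Real.cosh (L * t))⁻¹ • (x₀ + ∫ s in (0 : ℝ)..t, v (Real.cosh (L * s) • x s)) := fun x =>
    ((by fun_prop : Continuous fun s => Real.cosh (L * s)).inv₀ fun t => (hcosh t).ne').smul
      (continuous_iff_continuousAt.2 fun t => (hprim x t).continuousAt)
  have hΨb : ∀ x : ℝ →ᵇ E, ∀ t,
      ‖(Real.cosh (L * t))⁻¹ • (x₀ + ∫ s in (0 : ℝ)..t, v (Real.cosh (L * s) • x s))‖ ≤
        ‖x₀‖ + (‖v 0‖ + K * ‖x‖) / L := by
    intro x t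
    have h1 : ∀ s, ‖v (Real.cosh (L * s) • x s)‖ ≤ (‖v 0‖ + K * ‖x‖) * Real.cosh (L * s) := by
      intro s
      refine (hgrow _).trans ?_
      rw [norm_smul, Real.norm_of_nonneg (hcosh s).le]
      have h2 := x.norm_coe_le_norm s
      have h3 := Real.one_le_cosh (L * s)
      have h4 : (K : ℝ) * (Real.cosh (L * s) * ‖x s‖) ≤ K * (Real.cosh (L * s) * ‖x‖) := by
        gcongr
      nlinarith [norm_nonneg (v 0)]
    have h2 := norm_integral_le_cosh hL h1 t
    rw [norm_smul, norm_inv, Real.norm_of_nonneg (hcosh t).le, inv_mul_le_iff₀ (hcosh t)]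
    refine (norm_add_le _ _).trans ?_
    nlinarith [norm_nonneg x₀, Real.one_le_cosh (L * t)]
  let Ψ : (ℝ →ᵇ E) → (ℝ →ᵇ E) := fun x =>
    BoundedContinuousFunction.ofNormedAddCommGroup _ (hΨc x) _ (hΨb x)
  have hΨ : ContractingWith (1 / 2) Ψ := by
    refine ⟨by rw [← NNReal.coe_lt_coe]; norm_num, LipschitzWith.of_dist_le_mul fun x y => ?_⟩
    rw [dist_eq_norm, dist_eq_norm, BoundedContinuousFunction.norm_le (by positivity)]
    intro t
    have h1 : ∀ s, ‖v (Real.cosh (L * s) • x s) - v (Real.cosh (L * s) • y s)‖ ≤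
        (K * ‖x - y‖) * Real.cosh (L * s) := by
      intro s
      refine (hv.norm_sub_le _ _).trans ?_
      rw [← smul_sub, norm_smul, Real.norm_of_nonneg (hcosh s).le]
      have h2 := (x - y).norm_coe_le_norm s
      rw [BoundedContinuousFunction.sub_apply] at h2
      rw [mul_assoc, mul_comm ‖x - y‖]
      gcongr
    have h2 := norm_integral_le_cosh hL h1 t
    rw [intervalIntegral.integral_sub ((hcont x).intervalIntegrable _ _)
      ((hcont y).intervalIntegrable _ _)] at h2
    change ‖(Real.cosh (L * t))⁻¹ • (x₀ + ∫ s in (0 : ℝ)..t, v (Real.cosh (L * s) • x s)) -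
      (Real.cosh (L * t))⁻¹ • (x₀ + ∫ s in (0 : ℝ)..t, v (Real.cosh (L * s) • y s))‖ ≤ _
    rw [← smul_sub, add_sub_add_left_eq_sub, norm_smul, norm_inv,
      Real.norm_of_nonneg (hcosh t).le, inv_mul_le_iff₀ (hcosh t), mul_comm]
    refine h2.trans (mul_le_mul_of_nonneg_right ?_ (hcosh t).le)
    rw [div_le_iff₀ hL]
    push_cast
    nlinarith [norm_nonneg (x - y)]
  obtain ⟨x, hx⟩ : ∃ x, Ψ x = x := ⟨_, hΨ.fixedPoint_isFixedPt⟩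
  have hx' : ∀ t, Real.cosh (L * t) • x t =
      x₀ + ∫ s in (0 : ℝ)..t, v (Real.cosh (L * s) • x s) := by
    intro t
    have h1 : (Real.cosh (L * t))⁻¹ • (x₀ + ∫ s in (0 : ℝ)..t, v (Real.cosh (L * s) • x s)) = x t :=
      DFunLike.congr_fun hx t
    rw [← h1, smul_inv_smul₀ (hcosh t).ne']
  refine ⟨fun t => Real.cosh (L * t) • x t, (hx' 0).trans (by simp), fun t => ?_⟩
  exact (hprim x t).congr_of_eventuallyEq (Filter.Eventually.of_forall hx')

end GlobalFlow

/-! ### The profile function `g`. -/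

namespace CMC

/-- Half of the derivative of `q₁`. -/
noncomputable def force (n : ℕ) (h t : ℝ) : ℝ :=
  -t * (1 + (n - 1) * (h + t ^ (-(n : ℤ))) ^ 2 - n * h * (h + t ^ (-(n : ℤ))))

theorem hasDerivAt_zpow_neg (n : ℕ) {t : ℝ} (ht : 0 < t) :
    HasDerivAt (fun t : ℝ => t ^ (-(n : ℤ))) (-n * t ^ (-(n : ℤ)) / t) t := by
  refine (hasDerivAt_zpow (-(n : ℤ)) t (Or.inl ht.ne')).congr_deriv ?_
  rw [zpow_sub_one₀ ht.ne']
  push_cast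
  ring

theorem hasDerivAt_q₁ (n : ℕ) (h c : ℝ) {t : ℝ} (ht : 0 < t) :
    HasDerivAt (q₁ n h c) (2 * force n h t) t := by
  have h1 := (hasDerivAt_zpow_neg n ht).const_add h
  have h2 := ((hasDerivAt_pow 2 t).const_sub c).add ((hasDerivAt_pow 2 t).mul (h1.pow 2))
  refine h2.congr_deriv ?_
  simp only [force, Pi.pow_apply]
  field_simp
  push_cast
  ring

theorem hasDerivAt_force (n : ℕ) (h : ℝ) {t : ℝ} (ht : 0 < t) :
    HasDerivAt (force n h)
      (-(1 + (n - 1) * (h + t ^ (-(n : ℤ))) ^ 2 - n * h * (h + t ^ (-(n : ℤ)))) +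
        n * t ^ (-(n : ℤ)) * (2 * (n - 1) * (h + t ^ (-(n : ℤ))) - n * h)) t := by
  have h1 := (hasDerivAt_zpow_neg n ht).const_add h
  have h2 := (hasDerivAt_id t).neg.mul
    ((((h1.pow 2).const_mul ((n : ℝ) - 1)).const_add 1).sub (h1.const_mul (n * h)))
  refine h2.congr_deriv ?_
  simp only [Pi.pow_apply, Pi.neg_apply, Pi.sub_apply, id]
  field_simp
  push_cast
  ring

theorem zpow_neg_natCast_le {n : ℕ} {a t : ℝ} (ha : 0 < a) (hat : a ≤ t) :
    t ^ (-(n : ℤ)) ≤ a ^ (-(n : ℤ)) := by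
  simp only [zpow_neg, zpow_natCast]
  gcongr

/-- The derivative of `force` depends on `t` only through `t ^ (-n)`, which stays in the compact
interval `[0, a ^ (-n)]` for `t ≥ a`. Freezing the force to the left of `a` extends the bound to the
whole line. -/
theorem exists_lipschitzWith_force (n : ℕ) (h : ℝ) {a : ℝ} (ha : 0 < a) :
    ∃ K, LipschitzWith K fun x => force n h (max a x) := by
  obtain ⟨C, hC⟩ := (isCompact_Icc (a := (0 : ℝ)) (b := a ^ (-(n : ℤ)))).exists_bound_of_continuousOn
    (f := fun s : ℝ => -(1 + (n - 1) * (h + s) ^ 2 - n * h * (h + s)) +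
        n * s * (2 * (n - 1) * (h + s) - n * h)) (by fun_prop)
  have h1 : LipschitzOnWith C.toNNReal (force n h) (Set.Ici a) := by
    refine (convex_Ici a).lipschitzOnWith_of_nnnorm_hasDerivWithin_le
      (fun t ht => (hasDerivAt_force n h (ha.trans_le ht)).hasDerivWithinAt) fun t ht => ?_
    rw [← NNReal.coe_le_coe, coe_nnnorm]
    exact (hC (t ^ (-(n : ℤ))) ⟨(zpow_pos (ha.trans_le ht) _).le,
      zpow_neg_natCast_le ha ht⟩).trans (Real.le_coe_toNNReal _)
  have h2 : LipschitzWith 1 fun x : ℝ => max a x := LipschitzWith.id.const_max a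
  refine ⟨C.toNNReal * 1, fun x y => ?_⟩
  have h3 := (h1.comp (h2.lipschitzOnWith (s := Set.univ)) fun x _ => le_max_left a x)
  exact h3 (Set.mem_univ x) (Set.mem_univ y)

theorem contDiffOn_force (n : ℕ) (h : ℝ) : ContDiffOn ℝ ∞ (force n h) (Set.Ioi 0) := by
  have h1 : ContDiffOn ℝ ∞ (fun t : ℝ => t ^ (-(n : ℤ))) (Set.Ioi 0) := by
    simp only [zpow_neg, zpow_natCast]
    exact (contDiff_id.pow n).contDiffOn.inv fun t ht => pow_ne_zero _ (Set.mem_Ioi.1 ht).ne'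
  unfold force
  exact contDiffOn_id.neg.mul ((contDiffOn_const.add (contDiffOn_const.mul
    ((contDiffOn_const.add h1).pow 2))).sub (contDiffOn_const.mul (contDiffOn_const.add h1)))

/-- Solutions of `g'' = F(g)` with `F` smooth are smooth. -/
theorem contDiff_of_second_order {F g p : ℝ → ℝ} {s : Set ℝ} (hF : ContDiffOn ℝ ∞ F s)
    (hs : ∀ t, g t ∈ s) (hg : ∀ t, HasDerivAt g (p t) t)
    (hp : ∀ t, HasDerivAt p (F (g t)) t) : ContDiff ℝ ∞ g := by
  have hdg : deriv g = p := funext fun t => (hg t).deriv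
  have hdp : deriv p = F ∘ g := funext fun t => (hp t).deriv
  have key : ∀ m : ℕ, ContDiff ℝ m g ∧ ContDiff ℝ m p := by
    intro m
    induction m with
    | zero =>
      simp only [Nat.cast_zero, contDiff_zero]
      exact ⟨continuous_iff_continuousAt.2 fun t => (hg t).continuousAt,
        continuous_iff_continuousAt.2 fun t => (hp t).continuousAt⟩
    | succ m ih =>
      push_cast
      rw [contDiff_succ_iff_deriv, contDiff_succ_iff_deriv, hdg, hdp]
      refine ⟨⟨fun t => (hg t).differentiableAt, by simp, ih.2⟩,
        fun t => (hp t).differentiableAt, by simp, ?_⟩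
      exact (hF.of_le (by exact_mod_cast le_top)).comp_contDiff ih.1 hs
  exact contDiff_infty.2 fun m => (key m).1

/-- Oscillation above a barrier: motion in the potential `-q₁` started at rest at a point `b`,
with `q₁ < 0` at some `a < b`, stays to the right of `a`. -/
theorem exists_solution_above {n : ℕ} {h c a b : ℝ} (ha : 0 < a) (hab : a < b)
    (hfa : 0 ≤ force n h a) (hqa : q₁ n h c a < 0) (hqb : q₁ n h c b = 0) :
    ∃ g p : ℝ → ℝ, g 0 = b ∧ (∀ t, HasDerivAt g (p t) t) ∧
      (∀ t, HasDerivAt p (force n h (g t)) t) ∧ (∀ t, a < g t) ∧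
      ∀ t, p t ^ 2 = q₁ n h c (g t) := by
  obtain ⟨K, hK⟩ := exists_lipschitzWith_force n h ha
  have hv : LipschitzWith (max 1 (K * 1)) fun z : ℝ × ℝ => (z.2, force n h (max a z.1)) :=
    LipschitzWith.prod_snd.prodMk (hK.comp LipschitzWith.prod_fst)
  obtain ⟨γ, hγ0, hγ⟩ := hv.exists_forall_hasDerivAt (b, 0)
  have hg : ∀ t, HasDerivAt (fun t => (γ t).1) (γ t).2 t := fun t =>
    (hasFDerivAt_fst (p := γ t)).comp_hasDerivAt t (hγ t)
  have hp : ∀ t, HasDerivAt (fun t => (γ t).2) (force n h (max a (γ t).1)) t := fun t =>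
    (hasFDerivAt_snd (p := γ t)).comp_hasDerivAt t (hγ t)
  -- Potential of the frozen force: `q₁ - q₁ a` to the right of `a`, and nonpositive to the left
  -- because the frozen force is nonnegative.
  set Q : ℝ → ℝ := fun x => ∫ s in a..x, 2 * force n h (max a s) with hQdef
  have hQc : Continuous fun s => 2 * force n h (max a s) := continuous_const.mul hK.continuous
  have hQ : ∀ x, HasDerivAt Q (2 * force n h (max a x)) x := fun x =>
    (hQc.integral_hasStrictDerivAt a x).hasDerivAt
  have hQge : ∀ x, a ≤ x → Q x = q₁ n h c x - q₁ n h c a := by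
    intro x hx
    refine intervalIntegral.integral_eq_sub_of_hasDerivAt (fun s hs => ?_)
      (hQc.intervalIntegrable _ _)
    rw [Set.uIcc_of_le hx] at hs
    rw [max_eq_right hs.1]
    exact hasDerivAt_q₁ n h c (ha.trans_le hs.1)
  have hQle : ∀ x, x ≤ a → Q x ≤ 0 := by
    intro x hx
    have h1 : Q x = ∫ s in a..x, 2 * force n h a := by
      refine intervalIntegral.integral_congr fun s hs => ?_
      rw [Set.uIcc_of_ge hx] at hs
      simp only [max_eq_left hs.2]
    rw [h1, intervalIntegral.integral_const, smul_eq_mul]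
    exact mul_nonpos_of_nonpos_of_nonneg (by linarith) (by linarith)
  have hE : ∀ t, (γ t).2 ^ 2 - Q (γ t).1 = -Q b := by
    intro t
    have h1 : ∀ t, HasDerivAt (fun t => (γ t).2 ^ 2 - Q (γ t).1) 0 t := fun t =>
      (((hp t).pow 2).sub ((hQ _).comp t (hg t))).congr_deriv (by push_cast; ring)
    have h2 := is_const_of_deriv_eq_zero (fun t => (h1 t).differentiableAt)
      (fun t => (h1 t).deriv) t 0
    simpa [hγ0] using h2
  have hb : Q b = -q₁ n h c a := by rw [hQge b hab.le, hqb, zero_sub]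
  -- At a point `≤ a` energy conservation would give `p² ≤ q₁ a < 0`. The solution therefore never
  -- sees the modified part of the force.
  have hlt : ∀ t, a < (γ t).1 := by
    intro t
    by_contra! hcon
    have h1 := hE t
    have h2 := hQle _ hcon
    nlinarith [sq_nonneg (γ t).2]
  refine ⟨_, _, by simp [hγ0], hg, fun t => ?_, hlt, fun t => ?_⟩
  · exact (hp t).congr_deriv (by rw [max_eq_right (hlt t).le])
  · have h1 := hE t
    rw [hQge _ (hlt t).le, hb] at h1
    linarith

/-- The constant `c` enters `q₁` only additively, so it is set to `0` here and fixed later through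
`b`. -/
theorem exists_barrier {n : ℕ} (hn : 3 ≤ n) {h : ℝ}
    (hh : h ∈ Set.Ico (-1 : ℝ) (-(2 * Real.sqrt ((n : ℝ) - 1) / (n : ℝ)))) :
    ∃ a b : ℝ, 0 < a ∧ a < b ∧ 0 < force n h a ∧ 0 < force n h b ∧
      q₁ n h 0 a < q₁ n h 0 b ∧ h + a ^ (-(n : ℤ)) < 0 := by
  have hn' : (3 : ℝ) ≤ n := by exact_mod_cast hn
  have hn1 : (0 : ℝ) < n - 1 := by linarith
  have hneg : h < 0 := hh.2.trans_le (neg_nonpos.2 (by positivity))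
  have hdisc : 4 * ((n : ℝ) - 1) < (n * h) ^ 2 := by
    have h1 : 2 * Real.sqrt ((n : ℝ) - 1) < -(n * h) := by
      have h2 := hh.2
      rw [lt_neg, div_lt_iff₀ (by linarith)] at h2
      linarith
    have h3 := Real.sq_sqrt hn1.le
    nlinarith [Real.sqrt_nonneg ((n : ℝ) - 1)]
  -- The vertex of the quadratic `1 + (n-1)x² - nhx`. Since `n > 2` and `h < 0` it lies above `h`,
  -- so it is a value of `λ`.
  set l : ℝ := n * h / (2 * (n - 1)) with hl
  have hl' : l * (2 * (n - 1)) = n * h := by rw [hl]; field_simp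
  have hlneg : l < 0 := by nlinarith
  have hlh : 0 < l - h := by nlinarith
  obtain ⟨a, ha, hal⟩ : ∃ a : ℝ, 0 < a ∧ h + a ^ (-(n : ℤ)) = l := by
    refine ⟨((l - h)⁻¹) ^ ((n : ℝ)⁻¹), by positivity, ?_⟩
    rw [zpow_neg, zpow_natCast, Real.rpow_inv_natCast_pow (by positivity) (by omega), inv_inv]
    ring
  have hfa : 0 < force n h a := by
    rw [force, hal]
    -- The value at the vertex is `1 - (nh)² / (4(n-1))`.
    have h1 : 1 + ((n : ℝ) - 1) * l ^ 2 - n * h * l < 0 := by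
      rw [← hl'] at hdisc ⊢
      nlinarith
    nlinarith
  have h1 : ∀ᶠ b in nhdsWithin a (Set.Ioi a), 0 < force n h b :=
    ((hasDerivAt_force n h ha).continuousAt.eventually (lt_mem_nhds hfa)).filter_mono
      nhdsWithin_le_nhds
  have h2 : ∀ᶠ b in nhdsWithin a (Set.Ioi a), 0 < slope (q₁ n h 0) a b :=
    ((hasDerivAt_iff_tendsto_slope.1 (hasDerivAt_q₁ n h 0 ha)).eventually
      (lt_mem_nhds (by positivity))).filter_mono
        (nhdsWithin_mono _ fun x hx => (Set.mem_Ioi.1 hx).ne')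
  obtain ⟨b, ⟨hb1, hb2⟩, hb3⟩ := ((h1.and h2).and self_mem_nhdsWithin).exists
  have hb3 : a < b := hb3
  refine ⟨a, b, ha, hb3, hfa, hb1, ?_, by rw [hal]; exact hlneg⟩
  rw [slope_def_field, div_pos_iff_of_pos_right (sub_pos.2 hb3)] at hb2
  linarith

/-- The profile functions from which the hypersurfaces are built. -/
structure IsProfile (n : ℕ) (h c : ℝ) (g : ℝ → ℝ) : Prop where
  pos : 0 < c
  smooth : ContDiff ℝ ∞ g
  first : ∀ t, deriv g t ^ 2 = q₁ n h c (g t)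
  second : ∀ t, HasDerivAt (deriv g) (force n h (g t)) t
  bound : ∃ a, Real.sqrt c < a ∧ ∀ t, a ≤ g t
  lam_bound : ∃ δ, 0 < δ ∧ ∀ t, -1 ≤ lam n h g t ∧ lam n h g t ≤ -δ

theorem exists_isProfile {n : ℕ} (hn : 3 ≤ n) {h : ℝ}
    (hh : h ∈ Set.Ico (-1 : ℝ) (-(2 * Real.sqrt ((n : ℝ) - 1) / (n : ℝ)))) :
    ∃ c g, IsProfile n h c g ∧ ∃ s t, g s ≠ g t := by
  obtain ⟨a, b, ha, hab, hfa, hfb, hq, hla⟩ := exists_barrier hn hh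
  have hlam : ∀ t, a ≤ t → -1 < h + t ^ (-(n : ℤ)) ∧ h + t ^ (-(n : ℤ)) ≤ h + a ^ (-(n : ℤ)) := by
    intro t ht
    have h1 : 0 < t ^ (-(n : ℤ)) := zpow_pos (ha.trans_le ht) _
    exact ⟨by linarith [hh.1], by linarith [zpow_neg_natCast_le (n := n) ha ht]⟩
  -- This makes `b` a zero of `q₁`, and `c = b² (1 - λ(b)²)` is positive because `-1 < λ(b) < 0`.
  set c : ℝ := -q₁ n h 0 b with hc
  have hq0 : ∀ t, q₁ n h c t = c + q₁ n h 0 t := fun t => by simp only [q₁]; ring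
  have hcpos : 0 < c := by
    obtain ⟨h1, h2⟩ := hlam b hab.le
    have h3 : 0 < b ^ 2 := by nlinarith
    have h4 : (h + b ^ (-(n : ℤ))) ^ 2 < 1 := by nlinarith
    rw [hc, q₁]
    nlinarith
  -- From `q₁ a < q₁ b` one gets `c < a² (1 - λ(a)²)`, and `λ(a) ≠ 0`.
  have hca : Real.sqrt c < a := by
    rw [Real.sqrt_lt' ha]
    have h1 : c < -q₁ n h 0 a := by rw [hc]; linarith
    refine h1.trans ?_
    simp only [q₁]
    have : 0 < a ^ 2 * (h + a ^ (-(n : ℤ))) ^ 2 :=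
      mul_pos (by positivity) (by nlinarith)
    linarith
  obtain ⟨g, p, hg0, hg, hp, hlt, hE⟩ := exists_solution_above (n := n) (h := h) (c := c) ha hab
    hfa.le (by rw [hq0, hc]; linarith) (by rw [hq0, hc]; ring)
  have hdg : deriv g = p := funext fun t => (hg t).deriv
  refine ⟨c, g, ⟨hcpos, contDiff_of_second_order (contDiffOn_force n h)
    (fun t => ha.trans (hlt t)) hg hp, fun t => by rw [hdg, hE], fun t => by rw [hdg]; exact hp t,
    ⟨a, hca, fun t => (hlt t).le⟩, -(h + a ^ (-(n : ℤ))), by linarith, fun t => ?_⟩, ?_⟩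
  · have := hlam (g t) (hlt t).le
    simp only [lam]
    exact ⟨this.1.le, by linarith [this.2]⟩
  -- A constant solution would sit at an equilibrium, but the force at `b` is positive.
  · by_contra! hcon
    have h1 : g = fun _ => g 0 := funext fun t => hcon t 0
    have h2 : p = fun _ => 0 := by rw [← hdg, h1]; simp
    have h3 := hp 0
    rw [h2, hg0] at h3
    exact hfb.ne ((hasDerivAt_const _ _).unique h3)

end CMC

/-! ### From the profile to the warping functions `r`, `λ`, `μ`, `θ`. -/

namespace CMC

/-- The functions of one variable which govern the rotational hypersurface
`r y + √(r² - 1) B₂(θ)`: `l` and `m` are its principal curvatures. -/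
structure WarpData (r l m θ : ℝ → ℝ) : Prop where
  smooth_r : ContDiff ℝ ∞ r
  smooth_l : ContDiff ℝ ∞ l
  smooth_θ : ContDiff ℝ ∞ θ
  bound : ∃ ρ, 1 < ρ ∧ ∀ u, ρ ≤ r u
  first : ∀ u, deriv r u ^ 2 = 1 - r u ^ 2 + r u ^ 2 * l u ^ 2
  second : ∀ u, HasDerivAt (deriv r) (-r u + r u * l u * m u) u
  codazzi : ∀ u, HasDerivAt (fun u => r u * l u) (m u * deriv r u) u
  angle : ∀ u, HasDerivAt θ (r u * l u / (r u ^ 2 - 1)) u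
  angle_proper : ∀ M, ∃ U, ∀ u, |θ u| ≤ M → |u| ≤ U

/-- A function with slope at most `-κ / √(1 + u²)` takes bounded values on bounded sets only. -/
theorem exists_abs_le_of_deriv_le {θ θ' : ℝ → ℝ} {κ : ℝ} (hκ : 0 < κ) (h0 : θ 0 = 0)
    (hθ : ∀ u, HasDerivAt θ (θ' u) u) (hle : ∀ u, θ' u ≤ -(κ * (Real.sqrt (1 + u ^ 2))⁻¹)) (M : ℝ) :
    ∃ U, ∀ u, |θ u| ≤ M → |u| ≤ U := by
  -- `arsinh` has derivative `1 / √(1 + u²)`, so `θ + κ arsinh` is antitone and `|θ u| ≥ κ arsinh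
  -- |u|`.
  have hd : ∀ u, HasDerivAt (fun u => θ u + κ * Real.arsinh u)
      (θ' u + κ * (Real.sqrt (1 + u ^ 2))⁻¹) u := fun u =>
    (hθ u).add ((Real.hasDerivAt_arsinh u).const_mul κ)
  have hanti : Antitone fun u => θ u + κ * Real.arsinh u :=
    antitone_of_deriv_nonpos (fun u => (hd u).differentiableAt) fun u => by
      rw [(hd u).deriv]; linarith [hle u]
  refine ⟨Real.sinh (M / κ), fun u hu => ?_⟩
  have hu' := abs_le.1 hu
  rcases le_total 0 u with h | h
  · have h1 := hanti h
    simp only [h0, Real.arsinh_zero, mul_zero, add_zero] at h1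
    rw [abs_of_nonneg h, ← Real.arsinh_le_arsinh, Real.arsinh_sinh, le_div_iff₀ hκ]
    linarith
  · have h1 := hanti h
    simp only [h0, Real.arsinh_zero, mul_zero, add_zero] at h1
    rw [abs_of_nonpos h, ← Real.arsinh_le_arsinh, Real.arsinh_sinh, le_div_iff₀ hκ,
      Real.arsinh_neg]
    linarith

theorem IsProfile.warpData {n : ℕ} {h c : ℝ} {g : ℝ → ℝ} (H : IsProfile n h c g) :
    WarpData (rad c g) (lam n h g) (fun u => n * h - (n - 1) * lam n h g u) (theta n h c g) := by
  obtain ⟨a, hca, hag⟩ := H.bound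
  obtain ⟨δ, hδ, hlam⟩ := H.lam_bound
  have hs : 0 < Real.sqrt c := Real.sqrt_pos.2 H.pos
  have hs2 : Real.sqrt c ^ 2 = c := Real.sq_sqrt H.pos.le
  have hgpos : ∀ u, 0 < g u := fun u => (hs.trans hca).trans_le (hag u)
  have hdg : ∀ u, HasDerivAt g (deriv g u) u := fun u =>
    (H.smooth.differentiable (by simp) u).hasDerivAt
  have hr : ∀ u, HasDerivAt (rad c g) (deriv g u / Real.sqrt c) u := fun u =>
    (hdg u).div_const _
  have hdr : deriv (rad c g) = fun u => deriv g u / Real.sqrt c := funext fun u => (hr u).deriv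
  have hl : ∀ u, HasDerivAt (lam n h g) (-n * g u ^ (-(n : ℤ)) / g u * deriv g u) u := fun u =>
    ((hasDerivAt_zpow_neg n (hgpos u)).comp u (hdg u)).const_add h
  have hsr : ContDiff ℝ ∞ (rad c g) := H.smooth.div_const _
  have hsl : ContDiff ℝ ∞ (lam n h g) := by
    unfold lam
    simp only [zpow_neg, zpow_natCast]
    exact contDiff_const.add ((H.smooth.pow n).inv fun u => pow_ne_zero _ (hgpos u).ne')
  have hρ : 1 < a / Real.sqrt c := by rwa [one_lt_div hs]
  have hrρ : ∀ u, a / Real.sqrt c ≤ rad c g u := fun u => by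
    unfold rad; gcongr; exact hag u
  have hR : ∀ u, 0 < rad c g u ^ 2 - 1 := fun u => by nlinarith [hrρ u]
  have hsθ' : ContDiff ℝ ∞ fun u => rad c g u * lam n h g u / (rad c g u ^ 2 - 1) :=
    (hsr.mul hsl).div ((hsr.pow 2).sub contDiff_const) fun u => (hR u).ne'
  have hθ : ∀ u, HasDerivAt (theta n h c g)
      (rad c g u * lam n h g u / (rad c g u ^ 2 - 1)) u := fun u =>
    (hsθ'.continuous.integral_hasStrictDerivAt 0 u).hasDerivAt
  have hfirst : ∀ u, deriv (rad c g) u ^ 2 =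
      1 - rad c g u ^ 2 + rad c g u ^ 2 * lam n h g u ^ 2 := by
    intro u
    rw [hdr]
    simp only [rad, div_pow, hs2, H.first, q₁, lam]
    have := H.pos.ne'
    field_simp
  refine ⟨hsr, hsl, ?_, ⟨_, hρ, hrρ⟩, hfirst, fun u => ?_, fun u => ?_, hθ, ?_⟩
  · refine contDiff_infty_iff_deriv.2 ⟨fun u => (hθ u).differentiableAt, ?_⟩
    rwa [show deriv (theta n h c g) = _ from funext fun u => (hθ u).deriv]
  · rw [hdr]
    refine ((H.second u).div_const _).congr_deriv ?_
    simp only [force, rad, lam]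
    field_simp
    ring
  · refine ((hr u).mul (hl u)).congr_deriv ?_
    have := (hgpos u).ne'
    simp only [rad, lam, hdr]
    field_simp
    ring
  -- Since `-1 ≤ λ < 0`, the first-order equation gives `r'² = 1 - r² (1 - λ²) ≤ 1`, so `r` grows at
  -- most linearly.
  · have hr1 : ∀ u, |deriv (rad c g) u| ≤ 1 := fun u => by
      rw [← sq_le_one_iff_abs_le_one, hfirst]
      have h1 : lam n h g u ^ 2 ≤ 1 := by nlinarith [hlam u]
      nlinarith [sq_nonneg (rad c g u)]
    have hgrow : ∀ u, rad c g u ≤ rad c g 0 + |u| := fun u => by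
      have h1 := Convex.norm_image_sub_le_of_norm_deriv_le (f := rad c g) (s := Set.univ)
        (fun x _ => (hr x).differentiableAt) (fun x _ => hr1 x) convex_univ
        (Set.mem_univ 0) (Set.mem_univ u)
      simp only [Real.norm_eq_abs, sub_zero, one_mul] at h1
      linarith [le_abs_self (rad c g u - rad c g 0)]
    have hr0 : 0 < rad c g 0 := by linarith [hrρ 0]
    refine exists_abs_le_of_deriv_le (κ := δ / (rad c g 0 + 1)) (by positivity)
      (by simp [theta]) hθ fun u => ?_
    set w := Real.sqrt (1 + u ^ 2) with hw
    have hw2 : w ^ 2 = 1 + u ^ 2 := Real.sq_sqrt (by positivity)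
    have hw1 : 1 ≤ w := Real.one_le_sqrt.2 (by nlinarith)
    have hwu : |u| ≤ w := Real.abs_le_sqrt (by linarith)
    have hrw : rad c g u ≤ (rad c g 0 + 1) * w := by nlinarith [hgrow u]
    have hrp : 0 < rad c g u := by linarith [hrρ u]
    rw [div_le_iff₀ (hR u)]
    -- Follows from `r² - 1 ≤ r²` and `r ≤ (r(0) + 1) √(1 + u²)`.
    have h3 : δ / (rad c g 0 + 1) * w⁻¹ * (rad c g u ^ 2 - 1) ≤ δ * rad c g u := by
      rw [div_mul_eq_mul_div, div_mul_eq_mul_div, div_le_iff₀ (by positivity), ← div_eq_mul_inv,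
        div_mul_eq_mul_div, div_le_iff₀ (by positivity)]
      nlinarith [mul_le_mul_of_nonneg_left hrw (mul_pos hδ hrp).le]
    nlinarith [mul_le_mul_of_nonneg_left (hlam u).2 hrp.le]

end CMC

/-! ### The semi-Euclidean form and the tangent spaces of the cylinder. -/

namespace CMC

section Form

variable {n k : ℕ}

/-- The metric of `R_k^{n+2}` as a bilinear map. -/
noncomputable def formB (n k : ℕ) : V n →ₗ[ℝ] V n →ₗ[ℝ] ℝ :=
  LinearMap.mk₂ ℝ (form n k)
    (fun x y z => by
      simp only [form, ← Finset.sum_add_distrib, Pi.add_apply]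
      exact Finset.sum_congr rfl fun i _ => by split_ifs <;> ring)
    (fun a x y => by
      simp only [form, Finset.mul_sum, Pi.smul_apply, smul_eq_mul]
      exact Finset.sum_congr rfl fun i _ => by split_ifs <;> ring)
    (fun x y z => by
      simp only [form, ← Finset.sum_add_distrib, Pi.add_apply]
      exact Finset.sum_congr rfl fun i _ => by split_ifs <;> ring)
    (fun a x y => by
      simp only [form, Finset.mul_sum, Pi.smul_apply, smul_eq_mul]
      exact Finset.sum_congr rfl fun i _ => by split_ifs <;> ring)

theorem form_add_left (x y z : V n) : form n k (x + y) z = form n k x z + form n k y z :=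
  (formB n k).map_add₂ x y z

theorem form_add_right (x y z : V n) : form n k x (y + z) = form n k x y + form n k x z :=
  (formB n k x).map_add y z

theorem form_smul_left (a : ℝ) (x y : V n) : form n k (a • x) y = a * form n k x y :=
  (formB n k).map_smul₂ a x y

theorem form_smul_right (a : ℝ) (x y : V n) : form n k x (a • y) = a * form n k x y :=
  (formB n k x).map_smul a y

theorem form_comm (x y : V n) : form n k x y = form n k y x := by
  simp only [form, mul_comm]

theorem form_single_left (i : Fin (n + 2)) (v : V n) :
    form n k (Pi.single i 1) v = if (i : ℕ) < k then -v i else v i := by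
  rw [form, Finset.sum_eq_single i]
  · simp
  · intro j _ hj
    simp [Pi.single_eq_of_ne hj]
  · simp

/-- `B₃ = B₂'`. -/
noncomputable def B₃ (n k : ℕ) (t : ℝ) : V n := fun i =>
  if (i : ℕ) + 1 = k then Real.sinh t else if (i : ℕ) = k then Real.cosh t else 0

theorem hasDerivAt_B₂ (t : ℝ) : HasDerivAt (B₂ n k) (B₃ n k t) t := by
  refine hasDerivAt_pi.2 fun i => ?_
  simp only [B₂, B₃]
  split_ifs
  · exact Real.hasDerivAt_cosh t
  · exact Real.hasDerivAt_sinh t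
  · exact hasDerivAt_const _ _

theorem hasDerivAt_B₃ (t : ℝ) : HasDerivAt (B₃ n k) (B₂ n k t) t := by
  refine hasDerivAt_pi.2 fun i => ?_
  simp only [B₂, B₃]
  split_ifs
  · exact Real.hasDerivAt_sinh t
  · exact Real.hasDerivAt_cosh t
  · exact hasDerivAt_const _ _

theorem contDiff_B₂ : ContDiff ℝ ∞ (B₂ n k) := by
  refine contDiff_pi.2 fun i => ?_
  simp only [B₂]
  split_ifs
  exacts [Real.contDiff_cosh, Real.contDiff_sinh, contDiff_const]

theorem contDiff_B₃ : ContDiff ℝ ∞ (B₃ n k) := by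
  refine contDiff_pi.2 fun i => ?_
  simp only [B₃]
  split_ifs
  exacts [Real.contDiff_sinh, Real.contDiff_cosh, contDiff_const]

/-- The vector with entries `a`, `b` at the places `k` and `k + 1` (counted from one). -/
noncomputable def plane (n k : ℕ) (a b : ℝ) : V n := fun i =>
  if (i : ℕ) + 1 = k then a else if (i : ℕ) = k then b else 0

theorem plane_eq (hk : 1 ≤ k) (hkn : k ≤ n) (a b : ℝ) :
    plane n k a b = a • Pi.single ⟨k - 1, by omega⟩ 1 + b • Pi.single ⟨k, by omega⟩ 1 := by
  ext i
  simp only [plane, Pi.add_apply, Pi.smul_apply, Pi.single_apply, Fin.ext_iff, smul_eq_mul]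
  split_ifs <;> first | omega | simp

theorem form_plane (hk : 1 ≤ k) (hkn : k ≤ n) (a b : ℝ) (v : V n) :
    form n k (plane n k a b) v = -(a * v ⟨k - 1, by omega⟩) + b * v ⟨k, by omega⟩ := by
  rw [plane_eq hk hkn, form_add_left, form_smul_left, form_smul_left, form_single_left,
    form_single_left, if_pos (by simp; omega), if_neg (by simp)]
  ring

theorem form_plane_plane (hk : 1 ≤ k) (hkn : k ≤ n) (a b a' b' : ℝ) :
    form n k (plane n k a b) (plane n k a' b') = -(a * a') + b * b' := by
  rw [form_plane hk hkn]
  simp only [plane]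
  rw [if_pos (by omega), if_neg (by omega), if_pos trivial]

theorem form_plane_of_mem (hk : 1 ≤ k) (hkn : k ≤ n) (a b : ℝ) {v : V n} (hv : v ∈ subspace n k) :
    form n k (plane n k a b) v = 0 := by
  rw [form_plane hk hkn, hv _ (Or.inl (by simp; omega)), hv _ (Or.inr rfl)]
  ring

/-- `B₂` and `B₃` have square lengths `-1` and `1`, are orthogonal to each other, and span the
complement of `subspace`. All later metric computations reduce to this. -/
theorem form_frame (hk : 1 ≤ k) (hkn : k ≤ n) {v v' : V n} (hv : v ∈ subspace n k)
    (hv' : v' ∈ subspace n k) (t b d b' d' : ℝ) :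
    form n k (v + (b • B₂ n k t + d • B₃ n k t)) (v' + (b' • B₂ n k t + d' • B₃ n k t)) =
      form n k v v' - b * b' + d * d' := by
  have h2 : B₂ n k t = plane n k (Real.cosh t) (Real.sinh t) := rfl
  have h3 : B₃ n k t = plane n k (Real.sinh t) (Real.cosh t) := rfl
  simp only [form_add_left, form_add_right, form_smul_left, form_smul_right, h2, h3,
    form_plane_plane hk hkn, form_plane_of_mem hk hkn _ _ hv', form_comm v,
    form_plane_of_mem hk hkn _ _ hv]
  linear_combination (-b * b' + d * d') * Real.cosh_sq t

/-- The metric is nondegenerate on `T_y S_{k-1}^{n-1}`. -/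
theorem eq_zero_of_form_eq_zero {y v : V n} (hy : y ∈ innerSphere n k) (hv : v ∈ subspace n k)
    (hyv : form n k y v = 0)
    (h : ∀ v' ∈ subspace n k, form n k y v' = 0 → form n k v v' = 0) : v = 0 := by
  have hall : ∀ x ∈ subspace n k, form n k v x = 0 := by
    intro x hx
    -- The test vector `x - ⟨y, x⟩ y` is the projection of `x` to the tangent space; its second term
    -- does not contribute since `⟨y, v⟩ = 0`.
    have h1 := h (x + (-form n k y x) • y)
      ((subspace n k).add_mem hx ((subspace n k).smul_mem _ hy.1)) (by
        rw [form_add_right, form_smul_right, hy.2]; ring)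
    rwa [form_add_right, form_smul_right, form_comm v y, hyv, mul_zero, add_zero] at h1
  ext i
  by_cases hi : (i : ℕ) + 1 = k ∨ (i : ℕ) = k
  · exact hv i hi
  · have h1 := hall (Pi.single i 1) (by
      intro j hj
      refine Pi.single_eq_of_ne ?_ _
      rintro rfl
      exact hi hj)
    rw [form_comm, form_single_left] at h1
    split_ifs at h1 <;> simpa using h1

/-- Three independent linear conditions (two coordinates and `⟨y, ·⟩`) cut the tangent space out of
dimension `n + 3`. -/
theorem finrank_tangent (hk : 1 ≤ k) (hkn : k ≤ n) {p : V n × ℝ} (hp : p ∈ cylinder n k) :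
    Module.finrank ℝ (tangent n k p) = n := by
  let i : Fin (n + 2) := ⟨k - 1, by omega⟩
  let j : Fin (n + 2) := ⟨k, by omega⟩
  let L : (V n × ℝ) →ₗ[ℝ] ℝ × ℝ × ℝ :=
    ((LinearMap.proj i).prod ((LinearMap.proj j).prod (formB n k p.1))).comp (LinearMap.fst ℝ _ _)
  have hL : ∀ w, L w = (w.1 i, w.1 j, form n k p.1 w.1) := fun w => rfl
  have hker : LinearMap.ker L = tangent n k p := by
    ext w
    rw [LinearMap.mem_ker, hL, Prod.mk_eq_zero, Prod.mk_eq_zero]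
    constructor
    · rintro ⟨h1, h2, h3⟩
      refine ⟨?_, h3⟩
      rintro l (hl | hl)
      · rwa [show l = i from Fin.ext (by simp only [i]; omega)]
      · rwa [show l = j from Fin.ext hl]
    · rintro ⟨h1, h2⟩
      exact ⟨h1 i (Or.inl (by simp only [i]; omega)), h1 j (Or.inr rfl), h2⟩
  have hran : LinearMap.range L = ⊤ := by
    rw [LinearMap.range_eq_top]
    rintro ⟨a, b, d⟩
    refine ⟨(plane n k a b + d • p.1, 0), ?_⟩
    have h1 : form n k p.1 p.1 = 1 := hp.2
    have h2 := form_plane_of_mem hk hkn a b hp.1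
    rw [hL]
    simp only [form_comm p.1, form_add_left, form_smul_left, h1, h2, Pi.add_apply, Pi.smul_apply,
      hp.1 i (Or.inl (by simp only [i]; omega)), hp.1 j (Or.inr rfl), plane]
    rw [if_pos (by simp only [i]; omega), if_neg (by simp only [j]; omega),
      if_pos (by simp only [j])]
    simp
  have h := L.finrank_range_add_finrank_ker
  rw [hker, hran, finrank_top] at h
  simp only [Module.finrank_prod, Module.finrank_self, Module.finrank_fin_fun] at h
  omega

end Form

/-! ### Maps expressed in the frame `y`, `B₂`, `B₃`. -/

section Hypersurface

variable {n k : ℕ}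

/-- Maps of the form `α y + β B₂(θ) + η B₃(θ)`. -/
noncomputable def frameMap (n k : ℕ) (α β η θ : ℝ → ℝ) (p : V n × ℝ) : V n :=
  α p.2 • p.1 + (β p.2 • B₂ n k (θ p.2) + η p.2 • B₃ n k (θ p.2))

theorem contDiff_frameMap {α β η θ : ℝ → ℝ} (hα : ContDiff ℝ ∞ α) (hβ : ContDiff ℝ ∞ β)
    (hη : ContDiff ℝ ∞ η) (hθ : ContDiff ℝ ∞ θ) : ContDiff ℝ ∞ (frameMap n k α β η θ) :=
  ((hα.comp contDiff_snd).smul contDiff_fst).add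
    (((hβ.comp contDiff_snd).smul (contDiff_B₂.comp (hθ.comp contDiff_snd))).add
      ((hη.comp contDiff_snd).smul (contDiff_B₃.comp (hθ.comp contDiff_snd))))

theorem fderiv_frameMap {α β η θ : ℝ → ℝ} {p : V n × ℝ} {α' β' η' θ' : ℝ}
    (hα : HasDerivAt α α' p.2) (hβ : HasDerivAt β β' p.2) (hη : HasDerivAt η η' p.2)
    (hθ : HasDerivAt θ θ' p.2) (w : V n × ℝ) :
    fderiv ℝ (frameMap n k α β η θ) p w = (α p.2 • w.1 + (w.2 * α') • p.1) +
      ((w.2 * (β' + η p.2 * θ')) • B₂ n k (θ p.2) +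
        (w.2 * (η' + β p.2 * θ')) • B₃ n k (θ p.2)) := by
  have hB2 := (hasDerivAt_B₂ (n := n) (k := k) (θ p.2)).scomp p.2 hθ
  have hB3 := (hasDerivAt_B₃ (n := n) (k := k) (θ p.2)).scomp p.2 hθ
  have hc := ((hβ.smul hB2).add (hη.smul hB3)).hasFDerivAt.comp p
    (hasFDerivAt_snd (𝕜 := ℝ) (p := p))
  have ha := (hα.hasFDerivAt.comp p (hasFDerivAt_snd (𝕜 := ℝ) (p := p))).smul
    (hasFDerivAt_fst (𝕜 := ℝ) (p := p))
  have h : HasFDerivAt (frameMap n k α β η θ) _ p := ha.add hc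
  rw [h.fderiv]
  ext i
  simp
  ring

theorem phi_eq_frameMap (h c : ℝ) (g : ℝ → ℝ) :
    phi n k h c g = frameMap n k (rad c g) (fun u => Real.sqrt (rad c g u ^ 2 - 1)) 0
      (theta n h c g) := by
  ext p i
  simp [phi, frameMap]

/-- The rotational hypersurface with profile `r` and angle `θ`. -/
noncomputable def hypersurface (n k : ℕ) (r θ : ℝ → ℝ) : V n × ℝ → V n :=
  frameMap n k r (fun u => Real.sqrt (r u ^ 2 - 1)) 0 θ

end Hypersurface
end CMC

/-! ### Geometry of the hypersurface: metric, normal, curvature, properness. -/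

namespace CMC

namespace WarpData

variable {n k : ℕ} {r l m θ : ℝ → ℝ}

theorem one_lt (H : WarpData r l m θ) (u : ℝ) : 1 < r u := by
  obtain ⟨ρ, h1, h2⟩ := H.bound
  exact h1.trans_le (h2 u)

theorem sub_one_pos (H : WarpData r l m θ) (u : ℝ) : 0 < r u ^ 2 - 1 := by
  nlinarith [H.one_lt u]

theorem sqrt_pos (H : WarpData r l m θ) (u : ℝ) : 0 < Real.sqrt (r u ^ 2 - 1) :=
  Real.sqrt_pos.2 (H.sub_one_pos u)

theorem sq_sqrt (H : WarpData r l m θ) (u : ℝ) : Real.sqrt (r u ^ 2 - 1) ^ 2 = r u ^ 2 - 1 :=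
  Real.sq_sqrt (H.sub_one_pos u).le

theorem hasDerivAt (H : WarpData r l m θ) (u : ℝ) : HasDerivAt r (deriv r u) u :=
  (H.smooth_r.differentiable (by simp) u).hasDerivAt

theorem hasDerivAt_sqrt (H : WarpData r l m θ) (u : ℝ) :
    HasDerivAt (fun u => Real.sqrt (r u ^ 2 - 1))
      (r u * deriv r u / Real.sqrt (r u ^ 2 - 1)) u := by
  refine ((((H.hasDerivAt u).pow 2).sub_const 1).sqrt (H.sub_one_pos u).ne').congr_deriv ?_
  simp only [Pi.pow_apply]
  push_cast
  ring

theorem contDiff_sqrt (H : WarpData r l m θ) : ContDiff ℝ ∞ fun u => Real.sqrt (r u ^ 2 - 1) :=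
  ((H.smooth_r.pow 2).sub contDiff_const).sqrt fun u => (H.sub_one_pos u).ne'

theorem contDiff_hypersurface (H : WarpData r l m θ) : ContDiff ℝ ∞ (hypersurface n k r θ) :=
  contDiff_frameMap H.smooth_r H.contDiff_sqrt contDiff_const H.smooth_θ

theorem fderiv_hypersurface (H : WarpData r l m θ) (p w : V n × ℝ) :
    fderiv ℝ (hypersurface n k r θ) p w = (r p.2 • w.1 + (w.2 * deriv r p.2) • p.1) +
      ((w.2 * (r p.2 * deriv r p.2 / Real.sqrt (r p.2 ^ 2 - 1))) • B₂ n k (θ p.2) +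
        (w.2 * (r p.2 * l p.2 / Real.sqrt (r p.2 ^ 2 - 1))) • B₃ n k (θ p.2)) := by
  rw [hypersurface, fderiv_frameMap (H.hasDerivAt _) (H.hasDerivAt_sqrt _)
    (show HasDerivAt (0 : ℝ → ℝ) 0 p.2 from hasDerivAt_const _ _) (H.angle _)]
  have h1 := (H.sqrt_pos p.2).ne'
  have h2 : Real.sqrt (r p.2 ^ 2 - 1) * (r p.2 * l p.2 / (r p.2 ^ 2 - 1)) =
      r p.2 * l p.2 / Real.sqrt (r p.2 ^ 2 - 1) := by
    rw [mul_div_assoc', div_eq_div_iff (H.sub_one_pos _).ne' h1]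
    linear_combination r p.2 * l p.2 * H.sq_sqrt p.2
  simp only [Pi.zero_apply, zero_mul, zero_add, add_zero, h2]

/-- The unit normal field of the hypersurface. -/
noncomputable def _root_.CMC.normalField (n k : ℕ) (r l θ : ℝ → ℝ) : V n × ℝ → V n :=
  frameMap n k (fun u => -(r u * l u)) (fun u => -(r u * (r u * l u) / Real.sqrt (r u ^ 2 - 1)))
    (fun u => -(deriv r u / Real.sqrt (r u ^ 2 - 1))) θ

theorem contDiff_normalField (H : WarpData r l m θ) : ContDiff ℝ ∞ (normalField n k r l θ) := by
  have h1 := H.smooth_r.mul H.smooth_l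
  have h2 : ∀ u, Real.sqrt (r u ^ 2 - 1) ≠ 0 := fun u => (H.sqrt_pos u).ne'
  exact contDiff_frameMap h1.neg ((H.smooth_r.mul h1).div H.contDiff_sqrt h2).neg
    ((contDiff_infty_iff_deriv.1 H.smooth_r).2.div H.contDiff_sqrt h2).neg H.smooth_θ

/-- The shape operator is diagonal: `λ` on vectors tangent to the sphere factor, `μ` on the `u`
direction. The `y` component is the Codazzi equation. -/
theorem fderiv_normalField (H : WarpData r l m θ) (p w : V n × ℝ) :
    fderiv ℝ (normalField n k r l θ) p w =
      -fderiv ℝ (hypersurface n k r θ) p (l p.2 • w.1, m p.2 * w.2) := by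
  have hR := (H.sqrt_pos p.2).ne'
  have hR2 := H.sq_sqrt p.2
  have h1 := H.first p.2
  have hα : HasDerivAt (fun u => -(r u * l u)) _ p.2 := (H.codazzi p.2).neg
  have hβ : HasDerivAt (fun u => -(r u * (r u * l u) / Real.sqrt (r u ^ 2 - 1))) _ p.2 :=
    (((H.hasDerivAt p.2).mul (H.codazzi p.2)).div (H.hasDerivAt_sqrt p.2) hR).neg
  have hη : HasDerivAt (fun u => -(deriv r u / Real.sqrt (r u ^ 2 - 1))) _ p.2 :=
    ((H.second p.2).div (H.hasDerivAt_sqrt p.2) hR).neg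
  rw [normalField, fderiv_frameMap hα hβ hη (H.angle _), H.fderiv_hypersurface]
  set R := Real.sqrt (r p.2 ^ 2 - 1)
  -- `e2` and `e3` compare the `B₂` and `B₃` components; `e3` needs both the first- and second-order
  -- equations for `r`.
  have e2 : -((deriv r p.2 * (r p.2 * l p.2) + r p.2 * (m p.2 * deriv r p.2)) * R -
      r p.2 * (r p.2 * l p.2) * (r p.2 * deriv r p.2 / R)) / R ^ 2 +
      -(deriv r p.2 / R) * (r p.2 * l p.2 / (r p.2 ^ 2 - 1)) =
      -(m p.2 * (r p.2 * deriv r p.2 / R)) := by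
    rw [← hR2]
    field_simp
    linear_combination (-deriv r p.2 * r p.2 * l p.2) * hR2
  have e3 : -((-r p.2 + r p.2 * l p.2 * m p.2) * R -
      deriv r p.2 * (r p.2 * deriv r p.2 / R)) / R ^ 2 +
      -(r p.2 * (r p.2 * l p.2) / R) * (r p.2 * l p.2 / (r p.2 ^ 2 - 1)) =
      -(m p.2 * (r p.2 * l p.2 / R)) := by
    rw [← hR2]
    field_simp
    linear_combination r p.2 * hR2 + r p.2 * h1
  ext i
  simp only [Pi.add_apply, Pi.smul_apply, smul_eq_mul, Pi.neg_apply, Pi.mul_apply]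
  linear_combination w.2 * B₂ n k (θ p.2) i * e2 + w.2 * B₃ n k (θ p.2) i * e3

theorem induced_eq (H : WarpData r l m θ) (hk : 1 ≤ k) (hkn : k ≤ n) {p w w' : V n × ℝ}
    (hp : p ∈ cylinder n k) (hw : w ∈ tangent n k p) (hw' : w' ∈ tangent n k p) :
    induced n k (hypersurface n k r θ) p w w' = r p.2 ^ 2 * form n k w.1 w'.1 + w.2 * w'.2 := by
  have hR := (H.sqrt_pos p.2).ne'
  have hR2 := H.sq_sqrt p.2
  have h1 := H.first p.2
  have hmem : ∀ {w : V n × ℝ}, w ∈ tangent n k p →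
      r p.2 • w.1 + (w.2 * deriv r p.2) • p.1 ∈ subspace n k := fun hw =>
    (subspace n k).add_mem ((subspace n k).smul_mem _ hw.1) ((subspace n k).smul_mem _ hp.1)
  have hy : form n k p.1 p.1 = 1 := hp.2
  rw [induced, H.fderiv_hypersurface, H.fderiv_hypersurface,
    form_frame hk hkn (hmem hw) (hmem hw')]
  simp only [form_add_left, form_smul_left, form_add_right, form_smul_right, hw'.2,
    form_comm w.1 p.1, hw.2, hy]
  set R := Real.sqrt (r p.2 ^ 2 - 1)
  -- The first-order equation says precisely that the profile curve has unit speed.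
  have e : deriv r p.2 ^ 2 - (r p.2 * deriv r p.2 / R) ^ 2 + (r p.2 * l p.2 / R) ^ 2 = 1 := by
    field_simp
    linear_combination (deriv r p.2 ^ 2 - 1) * hR2 - h1
  linear_combination w.2 * w'.2 * e

theorem mapsTo (H : WarpData r l m θ) (hk : 1 ≤ k) (hkn : k ≤ n) :
    Set.MapsTo (hypersurface n k r θ) (cylinder n k) (pseudoSphere n k) := by
  intro p hp
  have hy : form n k p.1 p.1 = 1 := hp.2
  have hm : r p.2 • p.1 ∈ subspace n k := (subspace n k).smul_mem _ hp.1
  simp only [pseudoSphere, Set.mem_ofPred_eq, hypersurface, frameMap]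
  rw [form_frame hk hkn hm hm, form_smul_left, form_smul_right, hy, ← sq, H.sq_sqrt]
  simp only [Pi.zero_apply]
  ring

theorem eq_zero_of_induced (H : WarpData r l m θ) (hk : 1 ≤ k) (hkn : k ≤ n) {p w : V n × ℝ}
    (hp : p ∈ cylinder n k) (hw : w ∈ tangent n k p)
    (h : ∀ w' ∈ tangent n k p, induced n k (hypersurface n k r θ) p w w' = 0) : w = 0 := by
  have h2 : w.2 = 0 := by
    have h01 : ((0, 1) : V n × ℝ) ∈ tangent n k p :=
      ⟨(subspace n k).zero_mem, (formB n k p.1).map_zero⟩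
    have h1 := h _ h01
    rw [H.induced_eq hk hkn hp hw h01] at h1
    have h3 : form n k w.1 0 = 0 := (formB n k w.1).map_zero
    simpa [h3] using h1
  refine Prod.ext (eq_zero_of_form_eq_zero hp hw.1 hw.2 fun v' hv' hyv' => ?_) h2
  have hv : (v', (0 : ℝ)) ∈ tangent n k p := ⟨hv', hyv'⟩
  have h1 := h _ hv
  rw [H.induced_eq hk hkn hp hw hv] at h1
  have h3 := H.one_lt p.2
  simpa [(by positivity : r p.2 ≠ 0)] using h1

theorem continuous_form (n k : ℕ) : Continuous fun z : V n × V n => form n k z.1 z.2 := by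
  unfold form
  refine continuous_finsetSum _ fun i _ => ?_
  split_ifs <;> fun_prop

theorem isClosed_cylinder (n k : ℕ) : IsClosed (cylinder n k) := by
  have h1 : IsClosed (subspace n k : Set (V n)) := (subspace n k).closed_of_finiteDimensional
  have h2 : IsClosed {y : V n | form n k y y = 1} :=
    isClosed_eq ((continuous_form n k).comp (continuous_id.prodMk continuous_id)) continuous_const
  exact (h1.inter h2).preimage continuous_fst

/-- The coordinate with value `√(r² - 1) cosh θ` bounds `θ`, hence `u`, because `r` stays away from
`1`; the coordinates `r yᵢ` bound `y` because `r > 1`. -/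
theorem exists_norm_le (H : WarpData r l m θ) (hk : 1 ≤ k) (hkn : k ≤ n) (M : ℝ) :
    ∃ C, ∀ p ∈ cylinder n k, ‖hypersurface n k r θ p‖ ≤ M → ‖p‖ ≤ C := by
  obtain ⟨ρ, hρ, hrρ⟩ := H.bound
  have hσ : 0 < Real.sqrt (ρ ^ 2 - 1) := Real.sqrt_pos.2 (by nlinarith)
  obtain ⟨U, hU⟩ := H.angle_proper (M / Real.sqrt (ρ ^ 2 - 1))
  refine ⟨max M U, fun p hp hM => ?_⟩
  have hM0 : 0 ≤ M := (norm_nonneg _).trans hM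
  have hcoord : ∀ i, |hypersurface n k r θ p i| ≤ M := fun i =>
    (norm_le_pi_norm (hypersurface n k r θ p) i).trans hM
  rw [Prod.norm_def]
  refine max_le_max ((pi_norm_le_iff_of_nonneg hM0).2 fun i => ?_) (hU _ ?_)
  · by_cases hi : (i : ℕ) + 1 = k ∨ (i : ℕ) = k
    · rw [hp.1 i hi, norm_zero]
      exact hM0
    · rw [not_or] at hi
      have h1 : hypersurface n k r θ p i = r p.2 * p.1 i := by
        simp [hypersurface, frameMap, B₂, hi]
      have h2 := hcoord i
      rw [h1, abs_mul] at h2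
      rw [Real.norm_eq_abs]
      nlinarith [abs_nonneg (p.1 i), le_abs_self (r p.2), H.one_lt p.2]
  · have h0 : hypersurface n k r θ p ⟨k - 1, by omega⟩ =
        Real.sqrt (r p.2 ^ 2 - 1) * Real.cosh (θ p.2) := by
      simp [hypersurface, frameMap, B₂, Nat.sub_add_cancel hk,
        hp.1 ⟨k - 1, by omega⟩ (Or.inl (by simp; omega))]
    have h1 := hcoord ⟨k - 1, by omega⟩
    rw [h0] at h1
    have h2 : Real.sqrt (ρ ^ 2 - 1) ≤ Real.sqrt (r p.2 ^ 2 - 1) := by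
      have := hrρ p.2
      gcongr
    rw [le_div_iff₀ hσ]
    have h3 : |θ p.2| ≤ Real.cosh (θ p.2) := by
      rw [← Real.cosh_abs]
      exact (Real.self_le_sinh_iff.2 (abs_nonneg _)).trans (Real.sinh_lt_cosh _).le
    rw [abs_of_nonneg (mul_nonneg (Real.sqrt_nonneg _) (Real.cosh_pos _).le)] at h1
    nlinarith [abs_nonneg (θ p.2)]

theorem isClosedImm (H : WarpData r l m θ) (hk : 1 ≤ k) (hkn : k ≤ n) :
    IsClosedImm n k (hypersurface n k r θ) where
  smooth := H.contDiff_hypersurface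
  mapsTo := H.mapsTo hk hkn
  injective p hp w hw h := H.eq_zero_of_induced hk hkn hp hw fun w' _ => by
    rw [induced, h]
    exact (formB n k).map_zero₂ _
  nondegenerate p hp w hw h := H.eq_zero_of_induced hk hkn hp hw h
  proper := by
    rw [isProperMap_iff_isCompact_preimage]
    have hc : Continuous (Set.MapsTo.restrict _ _ _ (H.mapsTo (θ := θ) hk hkn)) :=
      H.contDiff_hypersurface.continuous.restrict _
    refine ⟨hc, fun K hK => ?_⟩
    obtain ⟨M, hM⟩ := (hK.image continuous_subtype_val).isBounded.exists_norm_le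
    obtain ⟨C, hC⟩ := H.exists_norm_le hk hkn M
    rw [Subtype.isCompact_iff]
    refine Metric.isCompact_of_isClosed_isBounded
      ((isClosed_cylinder n k).isClosedEmbedding_subtypeVal.isClosedMap _
        (hK.isClosed.preimage hc)) (isBounded_iff_forall_norm_le.2 ⟨C, ?_⟩)
    rintro _ ⟨p, hp, rfl⟩
    exact hC _ p.2 (hM _ ⟨_, hp, rfl⟩)

theorem isGaussMap (H : WarpData r l m θ) (hk : 1 ≤ k) (hkn : k ≤ n) :
    IsGaussMap n k (hypersurface n k r θ) (normalField n k r l θ) where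
  smooth := H.contDiff_normalField
  tangent_ambient p hp := by
    have hR := (H.sqrt_pos p.2).ne'
    have hy : form n k p.1 p.1 = 1 := hp.2
    simp only [hypersurface, normalField, frameMap]
    rw [form_frame hk hkn ((subspace n k).smul_mem _ hp.1) ((subspace n k).smul_mem _ hp.1),
      form_smul_left, form_smul_right, hy]
    simp only [Pi.zero_apply]
    field_simp
    ring
  normal p hp w hw := by
    have hR := (H.sqrt_pos p.2).ne'
    have hR2 := H.sq_sqrt p.2
    have hy : form n k p.1 p.1 = 1 := hp.2
    rw [H.fderiv_hypersurface]
    simp only [normalField, frameMap]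
    rw [form_frame hk hkn ((subspace n k).smul_mem _ hp.1)
      ((subspace n k).add_mem ((subspace n k).smul_mem _ hw.1) ((subspace n k).smul_mem _ hp.1))]
    simp only [form_smul_left, form_add_right, form_smul_right, hy, hw.2]
    field_simp
    linear_combination -(r p.2 * l p.2 * w.2 * deriv r p.2) * hR2
  unit := by
    refine ⟨-1, Or.inr rfl, fun p hp => ?_⟩
    have hR := (H.sqrt_pos p.2).ne'
    have hR2 := H.sq_sqrt p.2
    have h1 := H.first p.2
    have hy : form n k p.1 p.1 = 1 := hp.2
    simp only [normalField, frameMap]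
    rw [form_frame hk hkn ((subspace n k).smul_mem _ hp.1) ((subspace n k).smul_mem _ hp.1),
      form_smul_left, form_smul_right, hy]
    field_simp
    linear_combination (r p.2 ^ 2 * l p.2 ^ 2 + 1) * hR2 + h1

theorem hasCMC (H : WarpData r l m θ) (hk : 1 ≤ k) (hkn : k ≤ n) {h : ℝ}
    (hm : ∀ u, (n - 1) * l u + m u = n * h) : HasCMC n k (hypersurface n k r θ) h := by
  refine ⟨_, H.isGaussMap hk hkn, fun p hp => ?_⟩
  let e : tangent n k p := ⟨(0, 1), (subspace n k).zero_mem, (formB n k p.1).map_zero⟩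
  -- The rank-one projection to the `u` direction, of trace `1`; the trace of `A` is then `n λ + (μ
  -- - λ)`.
  let P : tangent n k p →ₗ[ℝ] tangent n k p :=
    ((LinearMap.snd ℝ (V n) ℝ).comp (tangent n k p).subtype).smulRight e
  refine ⟨l p.2 • LinearMap.id + (m p.2 - l p.2) • P, fun w => ?_, ?_⟩
  · rw [H.fderiv_normalField]
    congr 2
    ext i <;> simp [P, e]
    ring
  · have hn : (n : ℝ) ≠ 0 := by
      have : 0 < n := by omega
      positivity
    rw [map_add, map_smul, map_smul, LinearMap.trace_smulRight, LinearMap.trace_id,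
      finrank_tangent hk hkn hp]
    simp only [e, LinearMap.comp_apply, Submodule.subtype_apply, LinearMap.snd_apply, smul_eq_mul]
    field_simp
    linear_combination hm p.2

end WarpData

end CMC

/-! ### Curves, lengths and completeness for `k = 1`. -/

namespace CMC

section Curves

variable {n k : ℕ}

theorem hasDerivWithinAt_form_self {y : ℝ → V n} {v : V n} {s : Set ℝ} {t : ℝ}
    (h : HasDerivWithinAt y v s t) :
    HasDerivWithinAt (fun t => form n k (y t) (y t)) (2 * form n k (y t) v) s t := by
  have hi := hasDerivWithinAt_pi.1 h
  have h1 : HasDerivWithinAt (fun t => form n k (y t) (y t))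
      (∑ i : Fin (n + 2), if (i : ℕ) < k then -(v i * y t i + y t i * v i)
        else v i * y t i + y t i * v i) s t := by
    refine HasDerivWithinAt.fun_sum fun i _ => ?_
    split_ifs
    · exact ((hi i).mul (hi i)).neg
    · exact (hi i).mul (hi i)
  refine h1.congr_deriv ?_
  rw [form, Finset.mul_sum]
  exact Finset.sum_congr rfl fun i _ => by split_ifs <;> ring

/-- Velocities of curves in `S_{k-1}^{n-1} × R` are tangent vectors. -/
theorem derivWithin_mem_tangent {γ : ℝ → V n × ℝ} (hγ : DifferentiableOn ℝ γ (Set.Icc 0 1))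
    (hc : ∀ t ∈ Set.Icc (0 : ℝ) 1, γ t ∈ cylinder n k) {t : ℝ} (ht : t ∈ Set.Icc (0 : ℝ) 1) :
    derivWithin γ (Set.Icc 0 1) t ∈ tangent n k (γ t) := by
  have hu : UniqueDiffWithinAt ℝ (Set.Icc (0 : ℝ) 1) t := uniqueDiffOn_Icc_zero_one t ht
  have h1 : HasDerivWithinAt (fun t => (γ t).1) (derivWithin γ (Set.Icc 0 1) t).1 (Set.Icc 0 1) t :=
    (hasFDerivAt_fst (𝕜 := ℝ) (p := γ t)).comp_hasDerivWithinAt t (hγ t ht).hasDerivWithinAt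
  refine ⟨fun i hi => ?_, ?_⟩
  · refine hu.eq_deriv _ (hasDerivWithinAt_pi.1 h1 i) ?_
    exact (hasDerivWithinAt_const t _ (0 : ℝ)).congr (fun s hs => (hc s hs).1 i hi)
      ((hc t ht).1 i hi)
  · have h2 := hu.eq_deriv _ (hasDerivWithinAt_form_self (k := k) h1)
      ((hasDerivWithinAt_const t _ (1 : ℝ)).congr (fun s hs => (hc s hs).2) (hc t ht).2)
    linarith

theorem form_self_eq_sum {v : V n} (hv : v ∈ subspace n 1) : form n 1 v v = ∑ i, v i ^ 2 := by
  refine Finset.sum_congr rfl fun i _ => ?_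
  split_ifs with hi
  · rw [hv i (Or.inl (by omega))]
    ring
  · ring

theorem sq_norm_le_form {v : V n} (hv : v ∈ subspace n 1) : ‖v‖ ^ 2 ≤ form n 1 v v := by
  rw [form_self_eq_sum hv]
  have h0 : 0 ≤ ∑ i, v i ^ 2 := Finset.sum_nonneg fun i _ => sq_nonneg _
  rw [← Real.le_sqrt (norm_nonneg _) h0, pi_norm_le_iff_of_nonneg (Real.sqrt_nonneg _)]
  intro i
  refine Real.le_sqrt_of_sq_le ?_
  rw [Real.norm_eq_abs, sq_abs]
  exact Finset.single_le_sum (f := fun i => v i ^ 2) (fun i _ => sq_nonneg _) (Finset.mem_univ i)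

/-- The chord from `y` to `y + d`, projected radially to the sphere. -/
noncomputable def chord (n : ℕ) (y d : V n) (t : ℝ) : V n :=
  (Real.sqrt (1 - t * form n 1 d d + t ^ 2 * form n 1 d d))⁻¹ • (y + t • d)

/-- When both ends of the chord lie on the sphere, `2⟨y, d⟩ = -D` and this quadratic is `⟨y + td, y
+ td⟩`. The bound keeps the chord away from the origin, so that it can be projected. -/
theorem half_le_sq_chord {D : ℝ} (h0 : 0 ≤ D) (h2 : D ≤ 2) (t : ℝ) :
    1 / 2 ≤ 1 - t * D + t ^ 2 * D := by
  nlinarith [mul_nonneg h0 (sq_nonneg (t - 1 / 2))]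

theorem contDiff_chord {y d : V n} (h0 : 0 ≤ form n 1 d d) (h2 : form n 1 d d ≤ 2) :
    ContDiff ℝ 1 (chord n y d) := by
  have hpos := fun t => (half_pos one_pos).trans_le (half_le_sq_chord h0 h2 t)
  have h1 : ContDiff ℝ 1 fun t : ℝ => 1 - t * form n 1 d d + t ^ 2 * form n 1 d d := by fun_prop
  exact ((h1.sqrt fun t => (hpos t).ne').inv fun t => (Real.sqrt_pos.2 (hpos t)).ne').smul
    (contDiff_const.add (contDiff_id.smul contDiff_const))

theorem chord_mem_innerSphere {y d : V n} (hy : y ∈ innerSphere n 1) (hd : d ∈ subspace n 1)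
    (hyd : 2 * form n 1 y d = -form n 1 d d) (h0 : 0 ≤ form n 1 d d) (h2 : form n 1 d d ≤ 2)
    (t : ℝ) : chord n y d t ∈ innerSphere n 1 := by
  have hpos := (half_pos one_pos).trans_le (half_le_sq_chord h0 h2 t)
  refine ⟨(subspace n 1).smul_mem _ ((subspace n 1).add_mem hy.1 ((subspace n 1).smul_mem _ hd)), ?_⟩
  have hS := Real.sq_sqrt hpos.le
  have hS' := (Real.sqrt_pos.2 hpos).ne'
  simp only [chord, form_add_left, form_add_right, form_smul_left, form_smul_right, hy.2,
    form_comm d y]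
  field_simp
  rw [hS]
  linear_combination t * hyd

theorem form_deriv_chord_le {y d : V n} (hy : form n 1 y y = 1)
    (hyd : 2 * form n 1 y d = -form n 1 d d) (h0 : 0 ≤ form n 1 d d) (h2 : form n 1 d d ≤ 2)
    (t : ℝ) : form n 1 (deriv (chord n y d) t) (deriv (chord n y d) t) ≤ 2 * form n 1 d d := by
  have hge := half_le_sq_chord h0 h2 t
  have hpos := (half_pos one_pos).trans_le hge
  set D := form n 1 d d with hD
  have h1 : HasDerivAt (fun t : ℝ => 1 - t * D + t ^ 2 * D) (-D + 2 * t * D) t := by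
    refine ((((hasDerivAt_id t).mul_const D).const_sub 1).add
      ((hasDerivAt_pow 2 t).mul_const D)).congr_deriv ?_
    push_cast
    ring
  have hS' := (Real.sqrt_pos.2 hpos)
  have hS := Real.sq_sqrt hpos.le
  have h3 : HasDerivAt (fun t : ℝ => y + t • d) d t := by
    simpa using ((hasDerivAt_id t).smul_const d).const_add y
  have h4 : HasDerivAt (chord n y d) _ t := ((h1.sqrt hpos.ne').inv hS'.ne').smul h3
  rw [h4.deriv]
  simp only [form_add_left, form_add_right, form_smul_left, form_smul_right, hy, form_comm d y,
    ← hD, Pi.inv_apply]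
  rw [show form n 1 y d = -D / 2 by linarith]
  set S := Real.sqrt (1 - t * D + t ^ 2 * D) with hSdef
  -- The squared speed of the projected chord is `D / S²` minus a square, and `S² ≥ 1/2`.
  have key : ∀ a : ℝ, a = (S⁻¹) ^ 2 * D - (-D + 2 * t * D) ^ 2 / (4 * S ^ 4) → a ≤ 2 * D := by
    rintro a rfl
    have h5 : (S⁻¹) ^ 2 ≤ 2 := by
      rw [inv_pow, hS]
      exact inv_le_of_inv_le₀ (by norm_num) (by linarith)
    have h6 : 0 ≤ (-D + 2 * t * D) ^ 2 / (4 * S ^ 4) := by positivity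
    nlinarith
  apply key
  field_simp
  linear_combination (-8) * (-D + 2 * t * D) ^ 2 * hS

end Curves

namespace WarpData

variable {n : ℕ} {r l m θ : ℝ → ℝ}

theorem isSpacelike (H : WarpData r l m θ) (hn : 1 ≤ n) :
    IsSpacelike n 1 (hypersurface n 1 r θ) := by
  intro p hp w hw hw0
  rw [H.induced_eq le_rfl hn hp hw hw]
  have h1 := sq_norm_le_form hw.1
  have h2 := H.one_lt p.2
  by_contra! hcon
  have h3 : 0 ≤ r p.2 ^ 2 * (form n 1 w.1 w.1 - ‖w.1‖ ^ 2) :=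
    mul_nonneg (sq_nonneg _) (sub_nonneg.2 h1)
  have h4 : 0 ≤ (r p.2 ^ 2 - 1) * ‖w.1‖ ^ 2 := mul_nonneg (H.sub_one_pos _).le (sq_nonneg _)
  have h5 : ‖w.1‖ ^ 2 = 0 := by nlinarith [sq_nonneg ‖w.1‖, mul_self_nonneg w.2]
  have h6 : w.2 * w.2 = 0 := by nlinarith [sq_nonneg ‖w.1‖, mul_self_nonneg w.2]
  exact hw0 (Prod.ext (by simpa using h5) (by simpa using h6))

theorem norm_le_sqrt_induced (H : WarpData r l m θ) (hn : 1 ≤ n) {p w : V n × ℝ}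
    (hp : p ∈ cylinder n 1) (hw : w ∈ tangent n 1 p) :
    ‖w‖ ≤ Real.sqrt (induced n 1 (hypersurface n 1 r θ) p w w) := by
  rw [H.induced_eq le_rfl hn hp hw hw, Prod.norm_def]
  have h1 := sq_norm_le_form hw.1
  have h2 := H.sub_one_pos p.2
  have h3 : 0 ≤ r p.2 ^ 2 * (form n 1 w.1 w.1 - ‖w.1‖ ^ 2) :=
    mul_nonneg (sq_nonneg _) (sub_nonneg.2 h1)
  have h4 : 0 ≤ (r p.2 ^ 2 - 1) * ‖w.1‖ ^ 2 := mul_nonneg h2.le (sq_nonneg _)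
  refine max_le (Real.le_sqrt_of_sq_le ?_) (Real.le_sqrt_of_sq_le ?_)
  · nlinarith [mul_self_nonneg w.2]
  · rw [Real.norm_eq_abs, sq_abs]
    nlinarith [sq_nonneg ‖w.1‖]

/-- Because `r > 1`, the induced norm of a velocity is at least its ambient sup norm, so each
admissible curve is at least as long as the ambient distance between its ends. -/
theorem edist_le_dist (H : WarpData r l m θ) (hn : 1 ≤ n) (p q : V n × ℝ) :
    edist p q ≤ dist n 1 (hypersurface n 1 r θ) p q := by
  refine le_iInf fun γ => le_iInf fun hγ => le_iInf fun hc => le_iInf fun h0 => le_iInf fun h1 => ?_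
  rw [edist_comm, edist_eq_enorm_sub, ← h0, ← h1]
  refine (enorm_sub_le_lintegral_derivWithin_Icc_of_contDiffOn_Icc hγ zero_le_one).trans ?_
  refine MeasureTheory.setLIntegral_mono' measurableSet_Icc fun t ht => ?_
  rw [← ofReal_norm]
  exact ENNReal.ofReal_le_ofReal (H.norm_le_sqrt_induced hn (hc t ht)
    (derivWithin_mem_tangent (hγ.differentiableOn one_ne_zero) hc ht))

/-- Tested on the curve that follows the projected chord in `y` and is affine in `u`; the bound
tends to `0` as `p` tends to `q` with `M` fixed. -/
theorem dist_le (H : WarpData r l m θ) (hn : 1 ≤ n) {p q : V n × ℝ}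
    (hp : p ∈ cylinder n 1) (hq : q ∈ cylinder n 1) {M : ℝ}
    (hD : form n 1 (q.1 - p.1) (q.1 - p.1) ≤ 2)
    (hM : ∀ t ∈ Set.Icc (0 : ℝ) 1, r (p.2 + t * (q.2 - p.2)) ≤ M) :
    dist n 1 (hypersurface n 1 r θ) p q ≤ ENNReal.ofReal (Real.sqrt
      (M ^ 2 * (2 * form n 1 (q.1 - p.1) (q.1 - p.1)) + (q.2 - p.2) * (q.2 - p.2))) := by
  set d := q.1 - p.1 with hd
  have hpq : q.1 = p.1 + d := by rw [hd]; abel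
  have hdm : d ∈ subspace n 1 := (subspace n 1).sub_mem hq.1 hp.1
  have h0 : 0 ≤ form n 1 d d := (sq_nonneg _).trans (sq_norm_le_form hdm)
  have hy : form n 1 p.1 p.1 = 1 := hp.2
  have hyd : 2 * form n 1 p.1 d = -form n 1 d d := by
    have h1 : form n 1 q.1 q.1 = 1 := hq.2
    rw [hpq] at h1
    simp only [form_add_left, form_add_right, hy, form_comm d p.1] at h1
    linarith
  let γ : ℝ → V n × ℝ := fun t => (chord n p.1 d t, p.2 + t * (q.2 - p.2))
  have hγ : ContDiff ℝ 1 γ := (contDiff_chord h0 hD).prodMk (by fun_prop)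
  have hc : ∀ t ∈ Set.Icc (0 : ℝ) 1, γ t ∈ cylinder n 1 := fun t _ =>
    chord_mem_innerSphere hp hdm hyd h0 hD t
  have hγ0 : γ 0 = p := Prod.ext (by simp [γ, chord]) (by simp [γ])
  have hγ1 : γ 1 = q := Prod.ext (by simp [γ, chord, hpq]) (by simp [γ])
  have hlen : dist n 1 (hypersurface n 1 r θ) p q ≤ length n 1 (hypersurface n 1 r θ) γ := by
    unfold dist
    exact iInf_le_of_le γ <| iInf_le_of_le hγ.contDiffOn <| iInf_le_of_le hc <|
      iInf_le_of_le hγ0 <| iInf_le_of_le hγ1 le_rfl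
  refine hlen.trans ?_
  have hint : ∀ t ∈ Set.Icc (0 : ℝ) 1, ENNReal.ofReal (Real.sqrt
      (induced n 1 (hypersurface n 1 r θ) (γ t) (derivWithin γ (Set.Icc 0 1) t)
        (derivWithin γ (Set.Icc 0 1) t))) ≤ ENNReal.ofReal (Real.sqrt
      (M ^ 2 * (2 * form n 1 d d) + (q.2 - p.2) * (q.2 - p.2))) := by
    intro t ht
    have htan := derivWithin_mem_tangent (hγ.differentiable one_ne_zero).differentiableOn hc ht
    have h1 : HasDerivAt γ (deriv (chord n p.1 d) t, q.2 - p.2) t := by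
      refine HasDerivAt.prodMk
        (((contDiff_chord h0 hD).differentiable one_ne_zero) t).hasDerivAt ?_
      simpa using ((hasDerivAt_id t).mul_const (q.2 - p.2)).const_add p.2
    rw [h1.hasDerivWithinAt.derivWithin (uniqueDiffOn_Icc_zero_one t ht)] at htan ⊢
    rw [H.induced_eq le_rfl hn (hc t ht) htan htan]
    refine ENNReal.ofReal_le_ofReal (Real.sqrt_le_sqrt (add_le_add_left ?_ _))
    have h2 := form_deriv_chord_le hy hyd h0 hD t
    have h3 : 0 ≤ r (γ t).2 := by linarith [H.one_lt (γ t).2]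
    have h4 : r (γ t).2 ≤ M := hM t ht
    have h5 := (sq_nonneg _).trans (sq_norm_le_form htan.1)
    exact mul_le_mul (pow_le_pow_left₀ h3 h4 2) h2 h5 (sq_nonneg _)
  refine (MeasureTheory.setLIntegral_mono' measurableSet_Icc hint).trans ?_
  simp

theorem isCompleteMetric (H : WarpData r l m θ) (hn : 1 ≤ n) :
    IsCompleteMetric n 1 (hypersurface n 1 r θ) := by
  intro x hx hcauchy
  have hC : CauchySeq x := EMetric.cauchySeq_iff.2 fun ε hε => by
    obtain ⟨N, hN⟩ := hcauchy ε hε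
    exact ⟨N, fun i hi j hj => (H.edist_le_dist hn _ _).trans_lt (hN i hi j hj)⟩
  obtain ⟨p, hp⟩ := cauchySeq_tendsto_of_complete hC
  have hpc : p ∈ cylinder n 1 := (isClosed_cylinder n 1).mem_of_tendsto hp
    (Filter.Eventually.of_forall hx)
  refine ⟨p, hpc, ?_⟩
  -- One bound for `r` on the unit interval around the limit serves all late terms, since the
  -- connecting curves keep `u` in that convex set.
  obtain ⟨M, hM⟩ := (isCompact_closedBall p.2 1).exists_bound_of_continuousOn
    H.smooth_r.continuous.continuousOn
  have hcont : Continuous fun z : V n × ℝ => form n 1 (p.1 - z.1) (p.1 - z.1) :=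
    (continuous_form n 1).comp
      ((continuous_const.sub continuous_fst).prodMk (continuous_const.sub continuous_fst))
  have hcont' : Continuous fun z : V n × ℝ => ENNReal.ofReal (Real.sqrt
      (M ^ 2 * (2 * form n 1 (p.1 - z.1) (p.1 - z.1)) + (p.2 - z.2) * (p.2 - z.2))) :=
    ENNReal.continuous_ofReal.comp (Real.continuous_sqrt.comp (by fun_prop))
  have hz : form n 1 (0 : V n) 0 = 0 := (formB n 1 0).map_zero
  have h1 := (hcont'.tendsto p).comp hp
  simp only [sub_self, hz, mul_zero, add_zero, Real.sqrt_zero, ENNReal.ofReal_zero] at h1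
  have h2 : ∀ᶠ i in Filter.atTop, form n 1 (p.1 - (x i).1) (p.1 - (x i).1) ≤ 2 := by
    have h3 := (hcont.tendsto p).comp hp
    simp only [sub_self, hz] at h3
    exact h3.eventually (Iic_mem_nhds two_pos)
  have h3 : ∀ᶠ i in Filter.atTop, (x i).2 ∈ Metric.closedBall p.2 1 :=
    ((continuous_snd.tendsto p).comp hp).eventually (Metric.closedBall_mem_nhds _ one_pos)
  refine tendsto_of_tendsto_of_tendsto_of_le_of_le' tendsto_const_nhds h1
    (Filter.Eventually.of_forall fun _ => zero_le) ?_
  filter_upwards [h2, h3] with i hi2 hi3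
  refine H.dist_le hn (hx i) hpc hi2 fun t ht => (le_abs_self _).trans (hM _ ?_)
  exact (convex_closedBall p.2 1).add_smul_sub_mem hi3 (Metric.mem_closedBall_self zero_le_one) ht

end WarpData

end CMC

theorem mainTheorem1 (n : ℕ) (hn : 3 ≤ n) (h : ℝ)
    (hh : h ∈ Set.Ico (-1 : ℝ) (-(2 * Real.sqrt ((n : ℝ) - 1) / (n : ℝ)))) :
    ∃ c : ℝ, 0 < c ∧ ∃ g : ℝ → ℝ,
      ContDiff ℝ ∞ g ∧
      (∀ t, (deriv g t) ^ 2 = CMC.q₁ n h c (g t)) ∧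
      (∃ s t, g s ≠ g t) ∧
      (∀ t, Real.sqrt c < g t) ∧
      (∀ k : ℕ, 1 ≤ k → k ≤ n →
        CMC.IsClosedImm n k (CMC.phi n k h c g) ∧ CMC.HasCMC n k (CMC.phi n k h c g) h) ∧
      CMC.IsSpacelike n 1 (CMC.phi n 1 h c g) ∧
      CMC.IsCompleteMetric n 1 (CMC.phi n 1 h c g) := by
  obtain ⟨c, g, H, hne⟩ := CMC.exists_isProfile hn hh
  have hn1 : 1 ≤ n := by omega
  obtain ⟨a, hca, hag⟩ := H.bound
  have W := H.warpData
  have hφ : ∀ k, CMC.phi n k h c g =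
      CMC.hypersurface n k (CMC.rad c g) (CMC.theta n h c g) := fun k =>
    CMC.phi_eq_frameMap h c g
  refine ⟨c, H.pos, g, H.smooth, H.first, hne, fun t => hca.trans_le (hag t), fun k hk hkn => ?_,
    ?_, ?_⟩
  · rw [hφ]
    exact ⟨W.isClosedImm hk hkn, W.hasCMC hk hkn fun u => by ring⟩
  · rw [hφ]
    exact W.isSpacelike hn1
  · rw [hφ]
    exact W.isCompleteMetric hn1
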